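/- **Theorem ($\Gamma$-convergence of the rate functions).** Let $d\in\{1,2,3\}$, let $\mathbb D\subset\mathbb R^d$ be a convex polygonal domain (a nonempty interior of the convex hull of finitely many points), $H:=L^2(\mathbb D)$ with norm $\|\cdot\|$, and let $A=-\Delta$ be the negative Dirichlet Laplacian on $\mathbb D$, with eigenpairs $(\lambda_k,\phi_k)_{k\ge1}$, $0<\lambda_1\le\lambda_2\le\cdots$, where $(\phi_k)$ is an orthonormal basis of $H$. Put $\|u\|_{\varpi}:=\|A^{\varpi/2}u\|=\big(\sum_k\lambda_k^{\varpi}\langle u,\phi_k\rangle^2\big)^{1/2}$, and let $\dot H^{\varpi}$ be the corresponding Hilbert space. Let $T>0$, $\alpha\in(0,1)$, $\beta\in(0,1]$, $\gamma\in[0,1]$ with $\alpha+\gamma>\frac12$, and assume: * (noise) $Q:H\to H$ is bounded, self-adjoint and positive semidefinite, and for some $\varepsilon_0>0$, with $\kappa:=\min\{(\alpha+\gamma-\frac12)\frac{2\beta}{\alpha},\,2\beta\}-\varepsilon_0$, there is $r\in(0,\kappa]$ such that the Hilbert--Schmidt norm of $A^{\frac{r-\kappa}2}Q^{\frac12}$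 on $H$ is finite; * (drift) $F:H\to H$ is (Gâteaux) differentiable, and there is $L>0$ with $\|F(u)\|\le L(1+\|u\|)$ and $\|F'(u)\psi\|\le L\|\psi\|$ for all $u,\psi\in H$; * (initial datum) $(\Omega,\mathscr F,\mathbb P)$ is a probability space and $X_0\in L^p(\Omega,\dot H^{2\beta})$ for some $p\ge2$. For $\eta\in[0,1]$ set $$\mathcal S_\eta(t)\psi:=t^{\alpha+\eta-1}\sum_{k\ge1}E_{\alpha,\alpha+\eta}(-\lambda_k^\beta t^\alpha)\langle\psi,\phi_k\rangle\phi_k,\qquad E_{a,b}(z)=\sum_{k\ge0}\frac{z^k}{\Gamma(ak+b)}.$$ Let $H_0:=Q^{1/2}(H)$ with norm $|u|_0:=\|Q^{-1/2}u\|$, where $Q^{-1/2}$ is the pseudo-inverse of $Q^{1/2}$. For an initial value $x_0\in\dot H^{2\beta}$, an integer $M\ge1$, $h=T/M$, $\lfloor s\rfloor_h:=h[s/h]$ ($[\cdot]$ the floor function) and $v\in L^2([0,T],H_0)$, let $Z^v$ and $Z^v_M$ be the solutions in $\mathcal C([0,T],H)$ of the skeleton equations on $[0,T]$ $$Z^v(t)=\mathcal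 S_{1-\alpha}(t)x_0+\int_0^t\mathcal S_0(t-s)F(Z^v(s))\,\mathrm ds+\int_0^t\mathcal S_\gamma(t-s)v(s)\,\mathrm ds,$$ $$Z^v_M(t)=\mathcal S_{1-\alpha}(t)x_0+\int_0^t\mathcal S_0(t-s)F(Z^v_M(\lfloor s\rfloor_h))\,\mathrm ds+\int_0^t\mathcal S_\gamma(t-s)v(s)\,\mathrm ds.$$ The rate functions of the exact equation and of the continuified Mittag--Leffler Euler (MLE) integrator with step $h=T/M$ are, for $x\in\mathcal C([0,T],H)$ and with $\inf\emptyset=\infty$, $$I(x)=\inf_{v\in L^2([0,T],H_0),\;x=Z^v}\frac12\int_0^T|v(s)|_0^2\,\mathrm ds,\qquad I^M(x)=\inf_{v\in L^2([0,T],H_0),\;x=Z^v_M}\frac12\int_0^T|v(s)|_0^2\,\mathrm ds.$$ Then for $\mathbb P$-almost every $\omega$, with $x_0=X_0(\omega)$ (in particular for every deterministic $X_0=x_0\in\dot H^{2\beta}$), the functions $I^M$ $\Gamma$-converge to $I$ on $\mathcal C([0,T],H)$ (with the supremum norm) as $M\to\infty$: 1. for every $x\in\mathcal C([0,T],H)$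 and every sequence $x_M\to x$ in $\mathcal C([0,T],H)$, $\ \liminf_{M\to\infty}I^M(x_M)\ge I(x)$; 2. for every $x\in\mathcal C([0,T],H)$ there is a sequence $x_M\to x$ in $\mathcal C([0,T],H)$ with $\ \limsup_{M\to\infty}I^M(x_M)\le I(x)$. -/

import Mathlib

open MeasureTheory Filter Set
open scoped ENNReal NNReal Topology InnerProductSpace

noncomputable section

namespace FracDiff

/-! ### The domain and the Dirichlet Laplacian -/

/-- `ℝᵈ` with its Euclidean norm. -/
abbrev Rd (d : ℕ) : Type := EuclideanSpace ℝ (Fin d)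

/-- A convex polygonal (polyhedral, for `d = 3`; an interval, for `d = 1`) domain: a nonempty open
set that is the interior of the convex hull of finitely many points. -/
def IsConvexPolygonalDomain {d : ℕ} (D : Set (Rd d)) : Prop :=
  D.Nonempty ∧ ∃ s : Finset (Rd d), D = interior (convexHull ℝ (s : Set (Rd d)))

/-- `L²(D)`. -/
abbrev L2 {d : ℕ} (D : Set (Rd d)) : Type := Lp ℝ 2 (volume.restrict D)

/-- Test functions, the elements of `C_c^∞(D)`. -/
def IsTest {d : ℕ} (D : Set (Rd d)) (f : Rd d → ℝ) : Prop :=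
  ContDiff ℝ (⊤ : ℕ∞) f ∧ HasCompactSupport f ∧ tsupport f ⊆ D

/-- `u` belongs to `H¹₀(D)` and has the gradient `g`: the pair `(u, g)` is the limit in
`L²(D) × L²(D)ᵈ` of a sequence `(fₙ, ∇ fₙ)` with test functions `fₙ`. -/
def HasH10Gradient {d : ℕ} (D : Set (Rd d)) (u : L2 D)
    (g : Lp (Rd d) 2 (volume.restrict D)) : Prop :=
  ∃ f : ℕ → Rd d → ℝ, (∀ n, IsTest D (f n)) ∧
    Tendsto (fun n => eLpNorm (fun x => f n x - u x) 2 (volume.restrict D)) atTop (𝓝 0) ∧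
    Tendsto (fun n => eLpNorm (fun x => gradient (f n) x - g x) 2 (volume.restrict D))
      atTop (𝓝 0)

/-- The graph of the negative Dirichlet Laplacian `A` on `L²(D)`: `u ∈ H¹₀(D)` and `- Δ u = f`
in the weak sense. -/
def IsNegDirichletLaplacian {d : ℕ} (D : Set (Rd d)) (u f : L2 D) : Prop :=
  ∃ g : Lp (Rd d) 2 (volume.restrict D), HasH10Gradient D u g ∧
    ∀ η : Rd d → ℝ, IsTest D η →
      ∫ x in D, ⟪g x, gradient η x⟫_ℝ = ∫ x in D, f x * η x

/-- `(lam k, φ k)`, `k = 0, 1, 2, …`, is the sequence of eigenpairs of the negative Dirichlet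
Laplacian, in nondecreasing order and with an orthonormal basis of eigenfunctions. -/
def IsDirichletEigensequence {d : ℕ} (D : Set (Rd d)) (lam : ℕ → ℝ)
    (φ : HilbertBasis ℕ ℝ (L2 D)) : Prop :=
  0 < lam 0 ∧ Monotone lam ∧ ∀ k, IsNegDirichletLaplacian D (φ k) (lam k • φ k)

/-! ### Square roots of positive operators, pseudo-inverses -/

section Hilbert

variable {H : Type*} [NormedAddCommGroup H] [InnerProductSpace ℝ H] [CompleteSpace H]

/-- Auxiliary iteration for the square root of `1 - B`. -/
def sqrtIter (B : H →L[ℝ] H) : ℕ → H →L[ℝ] H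
  | 0 => 0
  | n + 1 => (1 / 2 : ℝ) • (B + sqrtIter B n * sqrtIter B n)

/-- Scalar majorant of `sqrtIter`. -/
def sqrtIterR : ℕ → ℝ
  | 0 => 0
  | n + 1 => (1 / 2 : ℝ) * (1 + sqrtIterR n * sqrtIterR n)

lemma sqrtIterR_mem (n : ℕ) : 0 ≤ sqrtIterR n ∧ sqrtIterR n ≤ 1 := by
  induction n with
  | zero => simp [sqrtIterR]
  | succ n ih =>
    simp only [sqrtIterR]
    constructor <;> nlinarith [ih.1, ih.2]

lemma sqrtIterR_le_succ (n : ℕ) : sqrtIterR n ≤ sqrtIterR (n + 1) := by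
  simp only [sqrtIterR]
  nlinarith [sq_nonneg (sqrtIterR n - 1)]

lemma sqrtIter_norm_le {B : H →L[ℝ] H} (hB : ‖B‖ ≤ 1) (n : ℕ) :
    ‖sqrtIter B n‖ ≤ sqrtIterR n := by
  induction n with
  | zero => simp [sqrtIter, sqrtIterR]
  | succ n ih =>
    simp only [sqrtIter, sqrtIterR, norm_smul]
    rw [Real.norm_of_nonneg (by norm_num)]
    have h1 := norm_add_le B (sqrtIter B n * sqrtIter B n)
    have h2 := norm_mul_le (sqrtIter B n) (sqrtIter B n)
    have h3 : ‖sqrtIter B n‖ * ‖sqrtIter B n‖ ≤ sqrtIterR n * sqrtIterR n :=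
      mul_le_mul ih ih (norm_nonneg _) (sqrtIterR_mem n).1
    linarith

lemma sqrtIter_diff_le {B : H →L[ℝ] H} (hB : ‖B‖ ≤ 1) (n : ℕ) :
    ‖sqrtIter B (n + 1) - sqrtIter B n‖ ≤ sqrtIterR (n + 1) - sqrtIterR n := by
  induction n with
  | zero =>
    have := sqrtIter_norm_le hB 1
    simpa [sqrtIter, sqrtIterR] using this
  | succ n ih =>
    have e1 : sqrtIter B (n + 1 + 1) - sqrtIter B (n + 1) = (1 / 2 : ℝ) •
        (sqrtIter B (n + 1) * (sqrtIter B (n + 1) - sqrtIter B n)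
          + (sqrtIter B (n + 1) - sqrtIter B n) * sqrtIter B n) := by
      have key : ∀ X Y : H →L[ℝ] H, (1 / 2 : ℝ) • (B + X * X) - (1 / 2 : ℝ) • (B + Y * Y)
          = (1 / 2 : ℝ) • (X * (X - Y) + (X - Y) * Y) := by
        intro X Y
        rw [← smul_sub]
        congr 1
        noncomm_ring
      exact key (sqrtIter B (n + 1)) (sqrtIter B n)
    have e2 : sqrtIterR (n + 1 + 1) - sqrtIterR (n + 1) = (1 / 2 : ℝ) *
        (sqrtIterR (n + 1) * (sqrtIterR (n + 1) - sqrtIterR n)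
          + (sqrtIterR (n + 1) - sqrtIterR n) * sqrtIterR n) := by
      rw [show sqrtIterR (n + 1 + 1)
        = (1 / 2 : ℝ) * (1 + sqrtIterR (n + 1) * sqrtIterR (n + 1)) from rfl]
      have : sqrtIterR (n + 1) = (1 / 2 : ℝ) * (1 + sqrtIterR n * sqrtIterR n) := rfl
      linear_combination -this
    rw [e1, e2, norm_smul, Real.norm_of_nonneg (by norm_num)]
    have h0 := sqrtIterR_le_succ n
    have h1 := norm_add_le (sqrtIter B (n + 1) * (sqrtIter B (n + 1) - sqrtIter B n))
      ((sqrtIter B (n + 1) - sqrtIter B n) * sqrtIter B n)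
    have h2 := norm_mul_le (sqrtIter B (n + 1)) (sqrtIter B (n + 1) - sqrtIter B n)
    have h3 := norm_mul_le (sqrtIter B (n + 1) - sqrtIter B n) (sqrtIter B n)
    have h4 := mul_le_mul (sqrtIter_norm_le hB (n + 1)) ih (norm_nonneg _)
      (sqrtIterR_mem (n + 1)).1
    have h5 := mul_le_mul ih (sqrtIter_norm_le hB n) (norm_nonneg _) (by linarith)
    linarith

lemma exists_sqrt_of_norm_le_one {Q : H →L[ℝ] H} (hQ : Q.IsPositive) (h1 : ‖Q‖ ≤ 1) :
    ∃ R : H →L[ℝ] H, R.IsPositive ∧ R * R = Q := by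
  have hsym : ∀ x y, ⟪Q x, y⟫_ℝ = ⟪x, Q y⟫_ℝ := fun x y => hQ.1 x y
  have hpos : ∀ x, 0 ≤ ⟪Q x, x⟫_ℝ := fun x => by
    simpa [ContinuousLinearMap.reApplyInnerSelf_apply] using hQ.2 x
  set B : H →L[ℝ] H := 1 - Q with hBdef
  have hB : ‖B‖ ≤ 1 := by
    refine ContinuousLinearMap.opNorm_le_bound _ zero_le_one fun x => ?_
    have hBx : B x = x - Q x := by simp [hBdef]
    rw [hBx, one_mul]
    have a1 := hpos (x - Q x)
    have a2 : ⟪Q (Q x), Q x⟫_ℝ ≤ ‖Q x‖ ^ 2 := by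
      calc ⟪Q (Q x), Q x⟫_ℝ ≤ ‖Q (Q x)‖ * ‖Q x‖ := real_inner_le_norm _ _
        _ ≤ (1 * ‖Q x‖) * ‖Q x‖ := by
          gcongr
          exact (Q.le_opNorm _).trans (by gcongr)
        _ = ‖Q x‖ ^ 2 := by ring
    have a3 : ⟪Q (x - Q x), x - Q x⟫_ℝ
        = ⟪Q x, x⟫_ℝ - 2 * ‖Q x‖ ^ 2 + ⟪Q (Q x), Q x⟫_ℝ := by
      rw [map_sub, inner_sub_left, inner_sub_right, inner_sub_right, hsym (Q x) x,
        real_inner_self_eq_norm_sq]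
      ring
    have a4 : ‖x - Q x‖ ^ 2 = ‖x‖ ^ 2 - 2 * ⟪Q x, x⟫_ℝ + ‖Q x‖ ^ 2 := by
      rw [norm_sub_sq_real, real_inner_comm]
    refine le_of_sq_le_sq ?_ (norm_nonneg _)
    nlinarith [hpos x]
  have hRc : CauchySeq sqrtIterR := by
    have hm : Monotone sqrtIterR := monotone_nat_of_le_succ sqrtIterR_le_succ
    have hb : BddAbove (range sqrtIterR) := ⟨1, by rintro _ ⟨n, rfl⟩; exact (sqrtIterR_mem n).2⟩
    exact (tendsto_atTop_ciSup hm hb).cauchySeq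
  have hsub : ∀ n k, ‖sqrtIter B (n + k) - sqrtIter B n‖ ≤ sqrtIterR (n + k) - sqrtIterR n := by
    intro n k
    induction k with
    | zero => simp
    | succ k ih =>
      have := norm_sub_le_norm_sub_add_norm_sub (sqrtIter B (n + k + 1)) (sqrtIter B (n + k))
        (sqrtIter B n)
      have h2 := sqrtIter_diff_le hB (n + k)
      rw [← add_assoc]
      linarith
  have hc : CauchySeq (sqrtIter B) := by
    rw [Metric.cauchySeq_iff'] at hRc ⊢
    intro ε hε
    obtain ⟨N, hN⟩ := hRc ε hε
    refine ⟨N, fun n hn => ?_⟩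
    obtain ⟨k, rfl⟩ := Nat.exists_eq_add_of_le hn
    have h := hN (N + k) hn
    rw [Real.dist_eq] at h
    rw [dist_eq_norm]
    exact ((hsub N k).trans (le_abs_self _)).trans_lt h
  obtain ⟨Y, hY⟩ := cauchySeq_tendsto_of_complete hc
  have hYn : ‖Y‖ ≤ 1 :=
    le_of_tendsto hY.norm (Eventually.of_forall fun n =>
      (sqrtIter_norm_le hB n).trans (sqrtIterR_mem n).2)
  have hYe : Y = (1 / 2 : ℝ) • (B + Y * Y) := by
    refine tendsto_nhds_unique ((tendsto_add_atTop_iff_nat 1).2 hY) ?_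
    exact ((hY.mul hY).const_add B).const_smul (1 / 2 : ℝ)
  have hBs : ∀ x y, ⟪B x, y⟫_ℝ = ⟪x, B y⟫_ℝ := by
    intro x y
    simp [hBdef, inner_sub_left, inner_sub_right, hsym]
  have hYns : ∀ n x y, ⟪sqrtIter B n x, y⟫_ℝ = ⟪x, sqrtIter B n y⟫_ℝ := by
    intro n
    induction n with
    | zero => intro x y; simp [sqrtIter]
    | succ n ih =>
      intro x y
      simp [sqrtIter, inner_add_left, inner_add_right, inner_smul_left, inner_smul_right, hBs, ih]
  have hYs : ∀ x y, ⟪Y x, y⟫_ℝ = ⟪x, Y y⟫_ℝ := by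
    intro x y
    have hx : ∀ z, Tendsto (fun n => sqrtIter B n z) atTop (𝓝 (Y z)) := fun z =>
      ((ContinuousLinearMap.apply ℝ H z).continuous.tendsto Y).comp hY
    refine tendsto_nhds_unique ((hx x).inner tendsto_const_nhds) ?_
    simp_rw [hYns]
    exact tendsto_const_nhds.inner (hx y)
  refine ⟨1 - Y, ⟨fun x y => ?_, fun x => ?_⟩, ?_⟩
  · have := hYs x y
    simp [inner_sub_left, inner_sub_right] at this ⊢
    linarith
  · have h : ⟪Y x, x⟫_ℝ ≤ ⟪x, x⟫_ℝ := by
      rw [real_inner_self_eq_norm_sq]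
      calc ⟪Y x, x⟫_ℝ ≤ ‖Y x‖ * ‖x‖ := real_inner_le_norm _ _
        _ ≤ (1 * ‖x‖) * ‖x‖ := by
          gcongr
          exact (Y.le_opNorm _).trans (by gcongr)
        _ = ‖x‖ ^ 2 := by ring
    simp [ContinuousLinearMap.reApplyInnerSelf_apply, inner_sub_left] at h ⊢
    linarith
  · have h2 : (2 : ℝ) • Y = B + Y * Y := by
      conv_lhs => rw [hYe]
      rw [smul_smul]; norm_num
    have h3 : (1 - Y) * (1 - Y) = 1 - (2 : ℝ) • Y + Y * Y := by
      rw [two_smul]; noncomm_ring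
    rw [h3, h2, hBdef]
    abel

/-- A bounded positive semidefinite operator has a positive semidefinite square root. -/
lemma exists_sqrt {Q : H →L[ℝ] H} (hQ : Q.IsPositive) :
    ∃ R : H →L[ℝ] H, R.IsPositive ∧ R * R = Q := by
  set c : ℝ := (‖Q‖ + 1)⁻¹ with hc
  have hcp : 0 < c := by positivity
  have hQc : (c • Q).IsPositive := by
    refine ⟨fun x y => ?_, fun x => ?_⟩
    · have := hQ.1 x y
      simp [inner_smul_left, inner_smul_right] at this ⊢
      rw [this]; simp
    · have := hQ.2 x
      simp [ContinuousLinearMap.reApplyInnerSelf_apply, inner_smul_left] at this ⊢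
      positivity
  have hn : ‖c • Q‖ ≤ 1 := by
    rw [norm_smul, Real.norm_of_nonneg hcp.le, hc, inv_mul_le_iff₀ (by positivity)]
    linarith
  obtain ⟨R, hR, hRR⟩ := exists_sqrt_of_norm_le_one hQc hn
  refine ⟨Real.sqrt c⁻¹ • R, ⟨fun x y => ?_, fun x => ?_⟩, ?_⟩
  · have := hR.1 x y
    simp [inner_smul_left, inner_smul_right] at this ⊢
    rw [this]; simp
  · have := hR.2 x
    simp [ContinuousLinearMap.reApplyInnerSelf_apply, inner_smul_left] at this ⊢
    positivity
  · rw [smul_mul_smul_comm, hRR, smul_smul, Real.mul_self_sqrt (by positivity),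
      inv_mul_cancel₀ hcp.ne', one_smul]

open Classical in
/-- The positive semidefinite square root `Q^{1/2}` of a positive semidefinite `Q`
(`0` if `Q` is not positive semidefinite). -/
def posSqrt (Q : H →L[ℝ] H) : H →L[ℝ] H :=
  if hQ : Q.IsPositive then (exists_sqrt hQ).choose else 0

lemma posSqrt_spec {Q : H →L[ℝ] H} (hQ : Q.IsPositive) :
    (posSqrt Q).IsPositive ∧ posSqrt Q * posSqrt Q = Q := by
  rw [posSqrt, dif_pos hQ]
  exact (exists_sqrt hQ).choose_spec

lemma exists_pinv (R : H →L[ℝ] H) {u : H} (hu : ∃ w, R w = u) :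
    ∃ w, w ∈ (LinearMap.ker (R : H →ₗ[ℝ] H))ᗮ ∧ R w = u := by
  obtain ⟨w, rfl⟩ := hu
  have : CompleteSpace (LinearMap.ker (R : H →ₗ[ℝ] H)) :=
    (R.isClosed_ker).completeSpace_coe
  obtain ⟨y, hy, z, hz, hyz⟩ :=
    Submodule.exists_add_mem_mem_orthogonal (K := LinearMap.ker (R : H →ₗ[ℝ] H)) w
  refine ⟨z, hz, ?_⟩
  have : R y = 0 := hy
  rw [hyz, map_add, this, zero_add]

open Classical in
/-- The pseudo-inverse of `R` on the range of `R`: `pinv R u` is the preimage of `u` under `R` that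
is orthogonal to `ker R` (and `0` off the range of `R`). -/
def pinv (R : H →L[ℝ] H) (u : H) : H :=
  if hu : ∃ w, R w = u then (exists_pinv R hu).choose else 0

lemma pinv_spec (R : H →L[ℝ] H) {u : H} (hu : ∃ w, R w = u) :
    pinv R u ∈ (LinearMap.ker (R : H →ₗ[ℝ] H))ᗮ ∧ R (pinv R u) = u := by
  rw [pinv, dif_pos hu]
  exact (exists_pinv R hu).choose_spec

/-- The norm `|u|₀ = ‖Q^{-1/2} u‖` of the space `H₀ = Q^{1/2}(H)` (for `u ∈ H₀`). -/
def normH0 (Q : H →L[ℝ] H) (u : H) : ℝ≥0∞ := ‖pinv (posSqrt Q) u‖ₑ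

/-- `v ∈ L²([0,T], H₀)`. As `Q^{-1/2}` is an isometry of `H₀` into `H`, measurability and square
integrability of the `H₀`-valued `v` are those of the `H`-valued `Q^{-1/2} v`. -/
def IsControl (Q : H →L[ℝ] H) (T : ℝ) (v : ℝ → H) : Prop :=
  (∀ s ∈ Icc 0 T, ∃ w, posSqrt Q w = v s) ∧
    MemLp (fun s => pinv (posSqrt Q) (v s)) 2 (volume.restrict (Icc 0 T))

/-! ### Fractional norms, Mittag-Leffler functions, solution operators -/

/-- The norm `‖u‖_ϖ = ‖A^{ϖ/2} u‖ = (∑ₖ λₖ^ϖ ⟨u, φₖ⟩²)^{1/2}`, infinite if the series diverges. -/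
def sobNorm (lam : ℕ → ℝ) (φ : HilbertBasis ℕ ℝ H) (ϖ : ℝ) (u : H) : ℝ≥0∞ :=
  (∑' k, ENNReal.ofReal (lam k ^ ϖ * ⟪u, φ k⟫_ℝ ^ 2)) ^ (1 / 2 : ℝ)

/-- The Hilbert-Schmidt norm of `A^{ϖ/2} R`. -/
def hsNorm (lam : ℕ → ℝ) (φ : HilbertBasis ℕ ℝ H) (ϖ : ℝ) (R : H →L[ℝ] H) : ℝ≥0∞ :=
  (∑' j, sobNorm lam φ ϖ (R (φ j)) ^ 2) ^ (1 / 2 : ℝ)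

/-- The Mittag-Leffler function `E_{a,b}` on the real line. -/
def mittagLeffler (a b z : ℝ) : ℝ := ∑' k : ℕ, z ^ k / Real.Gamma (a * k + b)

/-- The solution operator `S_η(t)`. -/
def solOp (lam : ℕ → ℝ) (φ : HilbertBasis ℕ ℝ H) (α β η t : ℝ) (ψ : H) : H :=
  t ^ (α + η - 1) •
    ∑' k, (mittagLeffler α (α + η) (-(lam k ^ β) * t ^ α) * ⟪ψ, φ k⟫_ℝ) • φ k

/-! ### Assumptions on the noise and on the nonlinearity -/

/-- `κ = min {(α + γ - 1/2) 2β/α, 2β} - ε₀`. -/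
def kappa (α β γ ε₀ : ℝ) : ℝ := min ((α + γ - 1 / 2) * (2 * β / α)) (2 * β) - ε₀

/-- The assumption on the covariance operator, with parameters `ε₀ > 0` and `r ∈ (0, κ]`. -/
def NoiseAssumption (lam : ℕ → ℝ) (φ : HilbertBasis ℕ ℝ H) (α β γ : ℝ)
    (Q : H →L[ℝ] H) : Prop :=
  ∃ ε₀ > 0, ∃ r ∈ Ioc 0 (kappa α β γ ε₀),
    hsNorm lam φ (r - kappa α β γ ε₀) (posSqrt Q) < ∞

/-- The assumption on `F`: linear growth, and a (Gâteaux) derivative bounded by `L`. -/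
def DriftAssumption (F : H → H) : Prop :=
  ∃ L > 0, (∀ u, ‖F u‖ ≤ L * (1 + ‖u‖)) ∧
    ∃ F' : H → H →L[ℝ] H, (∀ u ψ, HasLineDerivAt ℝ F (F' u ψ) u ψ) ∧
      ∀ u ψ, ‖F' u ψ‖ ≤ L * ‖ψ‖

/-! ### Skeleton equations and rate functions -/

/-- `⌊s⌋_h = h [s / h]`. -/
def gridFloor (h s : ℝ) : ℝ := h * (⌊s / h⌋ : ℝ)

/-- `z ∈ C([0,T], H)` solves
`z(t) = S_{1-α}(t) x₀ + ∫₀ᵗ S₀(t-s) F(z(ρ(s))) ds + ∫₀ᵗ S_γ(t-s) v(s) ds`, `t ∈ [0,T]`. -/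
def IsSkeletonSolution (lam : ℕ → ℝ) (φ : HilbertBasis ℕ ℝ H) (α β γ : ℝ) (F : H → H)
    (x₀ : H) {T : ℝ} (hT : 0 < T) (ρ : ℝ → ℝ) (v : ℝ → H) (z : C(Icc (0 : ℝ) T, H)) : Prop :=
  ∀ t : Icc (0 : ℝ) T, z t =
    solOp lam φ α β (1 - α) t x₀
      + (∫ s in (0 : ℝ)..t, solOp lam φ α β 0 (t - s) (F (IccExtend hT.le z (ρ s))))
      + ∫ s in (0 : ℝ)..t, solOp lam φ α β γ (t - s) (v s)

/-- `inf {½ ∫₀ᵀ |v(s)|₀² ds : v ∈ L²([0,T], H₀), x is the skeleton solution driven by v}`,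
with `inf ∅ = ∞`. -/
def skeletonRate (lam : ℕ → ℝ) (φ : HilbertBasis ℕ ℝ H) (α β γ : ℝ) (F : H → H)
    (Q : H →L[ℝ] H) (x₀ : H) {T : ℝ} (hT : 0 < T) (ρ : ℝ → ℝ)
    (x : C(Icc (0 : ℝ) T, H)) : ℝ≥0∞ :=
  ⨅ (v : ℝ → H) (_ : IsControl Q T v) (_ : IsSkeletonSolution lam φ α β γ F x₀ hT ρ v x),
    (1 / 2) * ∫⁻ s in Icc 0 T, normH0 Q (v s) ^ 2

/-- The rate function `I` of the exact equation. -/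
def rateExact (lam : ℕ → ℝ) (φ : HilbertBasis ℕ ℝ H) (α β γ : ℝ) (F : H → H)
    (Q : H →L[ℝ] H) (x₀ : H) {T : ℝ} (hT : 0 < T) : C(Icc (0 : ℝ) T, H) → ℝ≥0∞ :=
  skeletonRate lam φ α β γ F Q x₀ hT id

/-- The rate function `I^M` of the continuified Mittag-Leffler Euler integrator with step
`h = T / M` (`M ≥ 1`). -/
def rateMLE (lam : ℕ → ℝ) (φ : HilbertBasis ℕ ℝ H) (α β γ : ℝ) (F : H → H)
    (Q : H →L[ℝ] H) (x₀ : H) {T : ℝ} (hT : 0 < T) (M : ℕ) : C(Icc (0 : ℝ) T, H) → ℝ≥0∞ :=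
  skeletonRate lam φ α β γ F Q x₀ hT (gridFloor (T / M))

end Hilbert

/-- Sequential `Γ`-convergence: the liminf inequality and the existence of recovery sequences. -/
def GammaConverges {X : Type*} [TopologicalSpace X] (J : ℕ → X → ℝ≥0∞) (I : X → ℝ≥0∞) : Prop :=
  (∀ (x : X) (y : ℕ → X), Tendsto y atTop (𝓝 x) →
      I x ≤ liminf (fun M => J M (y M)) atTop) ∧
  ∀ x : X, ∃ y : ℕ → X, Tendsto y atTop (𝓝 x) ∧
      limsup (fun M => J M (y M)) atTop ≤ I x

end FracDiff

end

open MeasureTheory Filter Set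
open scoped ENNReal NNReal Topology InnerProductSpace

noncomputable section

namespace FracDiff

/-! ### Mittag-Leffler functions on the negative half-line -/

/-! Everything rests on one kernel bound, `‖S_η(t)‖ ≤ t ^ (α + η - 1) / Γ(α + η)`, which comes from
`0 < E_{a,b}(-x) ≤ 1 / Γ(b)` for `x ≥ 0` and `b ≥ a` (`abs_mittagLeffler_neg_le`). It makes the
drift kernel `S_0` integrable and, because `α + γ > 1/2`, the control kernel `S_γ` square
integrable. Positivity of the Mittag-Leffler function follows from a first-zero argument in its
Volterra equation; the upper bound is then read off that equation.

Liminf inequality: write controls as `v = Q^{1/2} w` with `w` in a ball of `L²([0,T], H)`. Balls are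
weakly compact, the control integral tested against `φ k` is a continuous linear functional of `w`
(`exists_representer`), and the drift integral converges strongly because `F` is Lipschitz. So the
skeleton equation is closed under weak convergence of `w` together with uniform convergence of the
paths (`exists_control_of_tendsto`), and the energy is weakly lower semicontinuous. The same
closedness shows that a finite infimum defining `I` is attained.

Recovery sequence: keep the optimal control of `x` and let `x_M` be the Euler path it drives.
Subtracting the two equations cancels the initial term and the control integral, so `x_M - x` is a
convolution with `S_0` alone, in which the time lag of `x` is a uniformly small perturbation. An
exponentially weighted norm gives `x_M → x` (`dist_perturbed_solution_le`), and the cost of `x_M` is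
at most `I(x)`. -/

lemma beta_integral_unit {p q : ℝ} (hp : 0 < p) (hq : 0 < q) :
    IntervalIntegrable (fun u : ℝ => u ^ (p - 1) * (1 - u) ^ (q - 1)) volume 0 1 ∧
      ∫ u in (0 : ℝ)..1, u ^ (p - 1) * (1 - u) ^ (q - 1)
        = Real.Gamma p * Real.Gamma q / Real.Gamma (p + q) := by
  have hc := Complex.betaIntegral_convergent (u := (p : ℂ)) (v := (q : ℂ)) (by simpa) (by simpa)
  have hEq : ∀ u ∈ Ioc (0 : ℝ) 1, ((u : ℂ) ^ ((p : ℂ) - 1) * (1 - (u : ℂ)) ^ ((q : ℂ) - 1)) =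
      ((u ^ (p - 1) * (1 - u) ^ (q - 1) : ℝ) : ℂ) := by
    intro u hu
    rw [Complex.ofReal_mul, Complex.ofReal_cpow hu.1.le, Complex.ofReal_cpow (by linarith [hu.2])]
    push_cast
    rfl
  have hc' : IntegrableOn (fun u : ℝ => ((u ^ (p - 1) * (1 - u) ^ (q - 1) : ℝ) : ℂ))
      (Ioc 0 1) volume := by
    rw [intervalIntegrable_iff_integrableOn_Ioc_of_le zero_le_one] at hc
    exact hc.congr_fun hEq measurableSet_Ioc
  have hr : IntegrableOn (fun u : ℝ => u ^ (p - 1) * (1 - u) ^ (q - 1)) (Ioc 0 1) volume := by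
    simpa [IntegrableOn] using Integrable.re hc'
  refine ⟨by rwa [intervalIntegrable_iff_integrableOn_Ioc_of_le zero_le_one], ?_⟩
  have h1 := Complex.betaIntegral_eq_Gamma_mul_div (p : ℂ) (q : ℂ) (by simpa) (by simpa)
  have h2 : Complex.betaIntegral p q
      = ((∫ u in (0 : ℝ)..1, u ^ (p - 1) * (1 - u) ^ (q - 1) : ℝ) : ℂ) := by
    rw [Complex.betaIntegral, ← intervalIntegral.integral_ofReal]
    refine intervalIntegral.integral_congr_ae (Eventually.of_forall fun u hu => ?_)
    rw [uIoc_of_le zero_le_one] at hu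
    exact hEq u hu
  rw [h2, ← Complex.ofReal_add, Complex.Gamma_ofReal, Complex.Gamma_ofReal,
    Complex.Gamma_ofReal] at h1
  exact_mod_cast h1

lemma beta_integral {p q t : ℝ} (hp : 0 < p) (hq : 0 < q) (ht : 0 < t) :
    IntervalIntegrable (fun s : ℝ => s ^ (p - 1) * (t - s) ^ (q - 1)) volume 0 t ∧
      ∫ s in (0 : ℝ)..t, s ^ (p - 1) * (t - s) ^ (q - 1)
        = t ^ (p + q - 1) * (Real.Gamma p * Real.Gamma q / Real.Gamma (p + q)) := by
  obtain ⟨h1, h2⟩ := beta_integral_unit hp hq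
  have hsc : ∀ s ∈ Ioc 0 t, s ^ (p - 1) * (t - s) ^ (q - 1)
      = t ^ (p + q - 2) * ((t⁻¹ * s) ^ (p - 1) * (1 - t⁻¹ * s) ^ (q - 1)) := by
    intro s hs
    have e1 : s ^ (p - 1) = t ^ (p - 1) * (t⁻¹ * s) ^ (p - 1) := by
      rw [← Real.mul_rpow ht.le (by have := hs.1; positivity)]
      congr 1; field_simp
    have e2 : (t - s) ^ (q - 1) = t ^ (q - 1) * (1 - t⁻¹ * s) ^ (q - 1) := by
      rw [← Real.mul_rpow ht.le (by
        rw [sub_nonneg, inv_mul_le_iff₀ ht]; linarith [hs.2])]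
      congr 1; field_simp
    rw [e1, e2, show p + q - 2 = (p - 1) + (q - 1) by ring, Real.rpow_add ht]
    ring
  constructor
  · have h3 := (h1.comp_mul_left (c := t⁻¹)).const_mul (t ^ (p + q - 2))
    simp only [div_inv_eq_mul, one_mul, zero_mul] at h3
    refine h3.congr fun s hs => ?_
    rw [uIoc_of_le ht.le] at hs
    exact (hsc s hs).symm
  · rw [intervalIntegral.integral_congr_ae (g := fun s => t ^ (p + q - 2) *
      ((t⁻¹ * s) ^ (p - 1) * (1 - t⁻¹ * s) ^ (q - 1))) (Eventually.of_forall fun s hs => by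
        rw [uIoc_of_le ht.le] at hs; exact hsc s hs),
      intervalIntegral.integral_const_mul,
      intervalIntegral.integral_comp_mul_left (fun u => u ^ (p - 1) * (1 - u) ^ (q - 1))
        (inv_ne_zero ht.ne'), mul_zero, inv_mul_cancel₀ ht.ne', inv_inv, h2, smul_eq_mul,
      ← mul_assoc, ← Real.rpow_add_one ht.ne']
    ring_nf

/-- Log-convexity of `Γ` at `x = a (x + a - 1) + (1 - a) (x + a)`, combined with `Γ(x + a) = (x + a
- 1) Γ(x + a - 1)`. It makes consecutive coefficient ratios of the Mittag-Leffler series tend to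
zero. -/
lemma Gamma_le_Gamma_add_mul_rpow {a x : ℝ} (ha : a ∈ Ioo (0 : ℝ) 1) (hx : 1 < x) :
    Real.Gamma x ≤ Real.Gamma (x + a) * (x + a - 1) ^ (-a) := by
  have h := Real.Gamma_mul_add_mul_le_rpow_Gamma_mul_rpow_Gamma (s := x + a - 1) (t := x + a)
    (a := a) (b := 1 - a) (by linarith [ha.1]) (by linarith [ha.1]) ha.1 (by linarith [ha.2])
    (by ring)
  have hy : 0 < x + a - 1 := by linarith [ha.1]
  have hG : 0 < Real.Gamma (x + a - 1) := Real.Gamma_pos_of_pos hy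
  have e : Real.Gamma (x + a) = (x + a - 1) * Real.Gamma (x + a - 1) := by
    rw [← Real.Gamma_add_one hy.ne']; ring_nf
  have e2 : a * (x + a - 1) + (1 - a) * (x + a) = x := by ring
  rw [e2] at h
  refine h.trans (le_of_eq ?_)
  rw [e, Real.mul_rpow hy.le hG.le, Real.rpow_sub hy, Real.rpow_sub hG, Real.rpow_neg hy.le]
  simp only [Real.rpow_one]
  have := Real.rpow_pos_of_pos hG a
  have := Real.rpow_pos_of_pos hy a
  field_simp

lemma summable_mittagLeffler {a b : ℝ} (ha : a ∈ Ioo (0 : ℝ) 1) (hb : 0 < b) (z : ℝ) :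
    Summable fun k : ℕ => z ^ k / Real.Gamma (a * k + b) := by
  rcases eq_or_ne z 0 with rfl | hz
  · exact summable_of_ne_finset_zero (s := {0}) fun k hk => by
      have : k ≠ 0 := by simpa using hk
      simp [this]
  have hpos : ∀ k : ℕ, 0 < Real.Gamma (a * k + b) := fun k =>
    Real.Gamma_pos_of_pos (by have := ha.1; positivity)
  have htop : Tendsto (fun k : ℕ => a * (k : ℝ) + b) atTop atTop :=
    tendsto_atTop_add_const_right _ _ ((tendsto_natCast_atTop_atTop).const_mul_atTop ha.1)
  refine summable_of_ratio_test_tendsto_lt_one (l := 0) zero_lt_one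
    (Eventually.of_forall fun k => div_ne_zero (pow_ne_zero _ hz) (hpos k).ne') ?_
  have hlim : Tendsto (fun k : ℕ => |z| * (a * (k : ℝ) + b + a - 1) ^ (-a)) atTop (𝓝 0) := by
    have h1 : Tendsto (fun k : ℕ => a * (k : ℝ) + b + a - 1) atTop atTop := by
      have := tendsto_atTop_add_const_right _ (a - 1) htop
      refine this.congr fun k => by ring
    simpa using ((tendsto_rpow_neg_atTop ha.1).comp h1).const_mul |z|
  refine tendsto_of_tendsto_of_tendsto_of_le_of_le' tendsto_const_nhds hlim
    (Eventually.of_forall fun k => by positivity) ?_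
  filter_upwards [htop.eventually_gt_atTop 1] with k hk
  have h := Gamma_le_Gamma_add_mul_rpow ha hk
  have e : a * ((k + 1 : ℕ) : ℝ) + b = a * k + b + a := by push_cast; ring
  have hpos' := hpos (k + 1)
  rw [e] at hpos' ⊢
  rw [norm_div, norm_div, norm_pow, norm_pow, Real.norm_eq_abs, Real.norm_of_nonneg hpos'.le,
    Real.norm_of_nonneg (hpos k).le, pow_succ]
  have hz' : 0 < |z| ^ k := by positivity
  calc |z| ^ k * |z| / Real.Gamma (a * k + b + a) / (|z| ^ k / Real.Gamma (a * k + b))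
      = |z| * (Real.Gamma (a * k + b) / Real.Gamma (a * k + b + a)) := by
        have := hpos k
        field_simp
    _ ≤ _ := by
        gcongr
        rw [div_le_iff₀ hpos']
        exact h.trans (mul_comm _ _).le

lemma continuous_mittagLeffler {a b : ℝ} (ha : a ∈ Ioo (0 : ℝ) 1) (hb : 0 < b) :
    Continuous (mittagLeffler a b) := by
  rw [continuous_iff_continuousAt]
  intro z
  have hpos : ∀ k : ℕ, 0 < Real.Gamma (a * k + b) := fun k =>
    Real.Gamma_pos_of_pos (by have := ha.1; positivity)
  refine ContinuousOn.continuousAt (s := Icc (-(|z| + 1)) (|z| + 1)) ?_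
    (Icc_mem_nhds (by linarith [neg_abs_le z]) (by linarith [le_abs_self z]))
  refine continuousOn_tsum (fun k => by fun_prop)
    (summable_mittagLeffler ha hb (|z| + 1)) fun k x hx => ?_
  rw [norm_div, Real.norm_of_nonneg (hpos k).le, norm_pow, Real.norm_eq_abs]
  have := hpos k
  have := abs_le.2 hx
  gcongr

/-- The Volterra equation of `t ^ (b - 1) * E_{a,b}(-t ^ a)`. -/
lemma mittagLeffler_volterra {a b t : ℝ} (ha : a ∈ Ioo (0 : ℝ) 1) (hb : 0 < b) (ht : 0 < t) :
    IntervalIntegrable (fun s => s ^ (b - 1) * mittagLeffler a b (-s ^ a) * (t - s) ^ (a - 1))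
      volume 0 t ∧
    ∫ s in (0 : ℝ)..t, s ^ (b - 1) * mittagLeffler a b (-s ^ a) * (t - s) ^ (a - 1)
      = Real.Gamma a * (t ^ (b - 1) / Real.Gamma b
        - t ^ (b - 1) * mittagLeffler a b (-t ^ a)) := by
  have hint : IntervalIntegrable
      (fun s => s ^ (b - 1) * mittagLeffler a b (-s ^ a) * (t - s) ^ (a - 1)) volume 0 t := by
    have h1 := (beta_integral hb ha.1 ht).1.mul_continuousOn
      (g := fun s => mittagLeffler a b (-s ^ a))
      (((continuous_mittagLeffler ha hb).comp
        (Real.continuous_rpow_const ha.1.le).neg).continuousOn)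
    refine h1.congr fun s _ => ?_
    ring
  refine ⟨hint, ?_⟩
  have hpos : ∀ k : ℕ, 0 < Real.Gamma (a * k + b) := fun k =>
    Real.Gamma_pos_of_pos (by have := ha.1; positivity)
  have hb' : ∀ k : ℕ, 0 < a * k + b := fun k => by have := ha.1; positivity
  have hGa : 0 < Real.Gamma a := Real.Gamma_pos_of_pos ha.1
  -- The series is integrated term by term. Each beta integral raises the power of `t ^ a` by one
  -- and replaces `Γ(a k + b)` by `Γ(a (k + 1) + b)`, so the integrated series is the original one
  -- without its zeroth term.
  set f : ℕ → ℝ → ℝ := fun k s =>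
    ((-1) ^ k / Real.Gamma (a * k + b)) * (s ^ (a * k + b - 1) * (t - s) ^ (a - 1)) with hf
  have hfi : ∀ k, Integrable (f k) (volume.restrict (Ioc 0 t)) := fun k =>
    ((intervalIntegrable_iff_integrableOn_Ioc_of_le ht.le).1
      (beta_integral (hb' k) ha.1 ht).1).const_mul _
  have hsum : ∀ s ∈ Ioc 0 t, ∑' k, f k s
      = s ^ (b - 1) * mittagLeffler a b (-s ^ a) * (t - s) ^ (a - 1) := by
    intro s hs
    rw [mittagLeffler, mul_right_comm, ← tsum_mul_left]
    refine tsum_congr fun k => ?_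
    simp only [hf]
    rw [show a * k + b - 1 = (b - 1) + a * k by ring, Real.rpow_add hs.1, Real.rpow_mul hs.1.le,
      Real.rpow_natCast, neg_eq_neg_one_mul (s ^ a), mul_pow]
    ring
  have hval : ∀ k : ℕ, ∫ s in Ioc 0 t, s ^ (a * k + b - 1) * (t - s) ^ (a - 1)
      = t ^ (b - 1) * Real.Gamma a * Real.Gamma (a * k + b)
        * ((t ^ a) ^ (k + 1) / Real.Gamma (a * (k + 1 : ℕ) + b)) := by
    intro k
    rw [← intervalIntegral.integral_of_le ht.le, (beta_integral (hb' k) ha.1 ht).2,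
      show a * k + b + a - 1 = (b - 1) + a * (k + 1 : ℕ) by push_cast; ring, Real.rpow_add ht,
      Real.rpow_mul ht.le, Real.rpow_natCast,
      show a * k + b + a = a * (k + 1 : ℕ) + b by push_cast; ring]
    ring
  have hnorm : ∀ k : ℕ, ∫ s in Ioc 0 t, ‖f k s‖ = t ^ (b - 1) * Real.Gamma a
      * ((t ^ a) ^ (k + 1) / Real.Gamma (a * (k + 1 : ℕ) + b)) := by
    intro k
    have : ∀ s ∈ Ioc 0 t, ‖f k s‖
        = (Real.Gamma (a * k + b))⁻¹ * (s ^ (a * k + b - 1) * (t - s) ^ (a - 1)) := by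
      intro s hs
      have h0 : 0 ≤ s ^ (a * k + b - 1) * (t - s) ^ (a - 1) :=
        mul_nonneg (Real.rpow_nonneg hs.1.le _) (Real.rpow_nonneg (by linarith [hs.2]) _)
      simp only [hf]
      rw [norm_mul, Real.norm_of_nonneg h0, norm_div, norm_pow, norm_neg, norm_one, one_pow,
        Real.norm_of_nonneg (hpos k).le, one_div]
    rw [setIntegral_congr_fun measurableSet_Ioc this, integral_const_mul, hval]
    have := hpos k
    field_simp
  have hsm := summable_mittagLeffler ha hb (t ^ a)
  have hsm' := (summable_nat_add_iff 1).2 hsm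
  have key := hasSum_integral_of_summable_integral_norm hfi
    ((hsm'.mul_left (t ^ (b - 1) * Real.Gamma a)).congr fun k => (hnorm k).symm)
  rw [intervalIntegral.integral_of_le ht.le,
    ← setIntegral_congr_fun measurableSet_Ioc hsum, ← key.tsum_eq]
  have hterm : ∀ k : ℕ, ∫ s in Ioc 0 t, f k s = -(t ^ (b - 1) * Real.Gamma a)
      * ((-t ^ a) ^ (k + 1) / Real.Gamma (a * (k + 1 : ℕ) + b)) := by
    intro k
    simp only [hf]
    rw [integral_const_mul, hval, neg_pow (t ^ a) (k + 1), pow_succ (-1 : ℝ)]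
    have := hpos k
    field_simp
  simp_rw [hterm]
  rw [tsum_mul_left, mittagLeffler, (summable_mittagLeffler ha hb (-t ^ a)).tsum_eq_zero_add]
  simp
  ring

lemma mittagLeffler_zero {a b : ℝ} : mittagLeffler a b 0 = (Real.Gamma b)⁻¹ := by
  rw [mittagLeffler, tsum_eq_single 0 fun k hk => by simp [hk]]
  simp

/-- With `e s = s ^ (b - 1) * E_{a,b}(-s ^ a)`, suppose `t₀` is the first point where `e` is not
positive, and let `t₁` maximise `e` on a short interval ending at `t₀`. Comparing the Volterra
equations at `t₀` and `t₁` shows that the drop from `e t₁ > 0` to `e t₀ ≤ 0` must be paid for by the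
integral over `[t₁, t₀]`, which is too small. -/
lemma mittagLeffler_neg_rpow_pos {a b : ℝ} (ha : a ∈ Ioo (0 : ℝ) 1) (hb : a ≤ b) {t : ℝ}
    (ht : 0 ≤ t) : 0 < mittagLeffler a b (-t ^ a) := by
  have hb0 : 0 < b := ha.1.trans_le hb
  set g : ℝ → ℝ := fun t => mittagLeffler a b (-t ^ a) with hg
  have hgc : Continuous g :=
    (continuous_mittagLeffler ha hb0).comp (Real.continuous_rpow_const ha.1.le).neg
  have hGa : 0 < Real.Gamma a := Real.Gamma_pos_of_pos ha.1
  have hGb : 0 < Real.Gamma b := Real.Gamma_pos_of_pos hb0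
  have hg0 : 0 < g 0 := by
    simp [hg, Real.zero_rpow ha.1.ne', mittagLeffler_zero, hGb]
  by_contra! hneg
  set B : Set ℝ := {s | 0 ≤ s ∧ g s ≤ 0} with hB
  have hBne : B.Nonempty := ⟨t, ht, hneg⟩
  have hBbdd : BddBelow B := ⟨0, fun s hs => hs.1⟩
  have hBcl : IsClosed B := (isClosed_le continuous_const continuous_id).inter
    (isClosed_le hgc continuous_const)
  set t₀ := sInf B with ht₀
  have ht₀B : t₀ ∈ B := hBcl.csInf_mem hBne hBbdd
  have ht₀pos : 0 < t₀ := by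
    rcases ht₀B.1.eq_or_lt with h | h
    · have := ht₀B.2
      rw [← h] at this
      linarith
    · exact h
  have hpos : ∀ s, 0 ≤ s → s < t₀ → 0 < g s := fun s hs hst => by
    by_contra! h
    exact absurd (csInf_le hBbdd ⟨hs, h⟩) (not_le.2 hst)
  -- `δ ≤ t₀ / 2` will give `q ≥ 1/2`, and `δ ^ a / a < Γ(a) / 2` makes the last stretch of the
  -- integral smaller than `q * Γ(a) * e t₁`.
  obtain ⟨δ, hδ, hδ2, hδs⟩ : ∃ δ, 0 < δ ∧ δ ≤ t₀ / 2 ∧ δ ^ a / a < Real.Gamma a / 2 := by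
    have h1 : Tendsto (fun x : ℝ => x ^ a / a) (𝓝[>] 0) (𝓝 0) := by
      have := ((Real.continuous_rpow_const ha.1.le).tendsto 0).div_const a
      rw [Real.zero_rpow ha.1.ne', zero_div] at this
      exact this.mono_left nhdsWithin_le_nhds
    obtain ⟨δ, h⟩ := ((h1.eventually_lt_const (half_pos hGa)).and
      (Ioc_mem_nhdsGT (half_pos ht₀pos))).exists
    exact ⟨δ, h.2.1, h.2.2, h.1⟩
  set e : ℝ → ℝ := fun s => s ^ (b - 1) * g s with he
  have hec : ContinuousOn e (Icc (t₀ - δ) t₀) := by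
    refine ContinuousOn.mul (fun s hs => ?_) hgc.continuousOn
    have hs0 : s ≠ 0 := (show (0 : ℝ) < s by linarith [hs.1]).ne'
    exact (Real.continuousAt_rpow_const _ _ (Or.inl hs0)).continuousWithinAt
  obtain ⟨t₁, ht₁, hmax⟩ := isCompact_Icc.exists_isMaxOn
    (nonempty_Icc.2 (by linarith : t₀ - δ ≤ t₀)) hec
  have het : 0 < e t₁ := by
    have h1 : 0 < e (t₀ - δ) := by
      have := hpos (t₀ - δ) (by linarith) (by linarith)
      have : 0 < t₀ - δ := by linarith
      simp only [he]
      positivity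
    exact h1.trans_le (hmax (left_mem_Icc.2 (by linarith)))
  have ht₁pos : 0 < t₁ := by linarith [ht₁.1]
  have ht₁lt : t₁ < t₀ := by
    refine lt_of_le_of_ne ht₁.2 fun h => ?_
    rw [h] at het
    exact absurd het (not_lt.2 (mul_nonpos_of_nonneg_of_nonpos (by positivity) ht₀B.2))
  obtain ⟨i₀, v₀⟩ := mittagLeffler_volterra ha hb0 ht₀pos
  obtain ⟨i₁, v₁⟩ := mittagLeffler_volterra ha hb0 ht₁pos
  change IntervalIntegrable (fun s => e s * (t₀ - s) ^ (a - 1)) volume 0 t₀ at i₀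
  change IntervalIntegrable (fun s => e s * (t₁ - s) ^ (a - 1)) volume 0 t₁ at i₁
  change ∫ s in (0 : ℝ)..t₀, e s * (t₀ - s) ^ (a - 1)
    = Real.Gamma a * (t₀ ^ (b - 1) / Real.Gamma b - e t₀) at v₀
  change ∫ s in (0 : ℝ)..t₁, e s * (t₁ - s) ^ (a - 1)
    = Real.Gamma a * (t₁ ^ (b - 1) / Real.Gamma b - e t₁) at v₁
  have he₀ : e t₀ ≤ 0 := mul_nonpos_of_nonneg_of_nonpos (by positivity) ht₀B.2
  have i₀l : IntervalIntegrable (fun s => e s * (t₀ - s) ^ (a - 1)) volume 0 t₁ :=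
    i₀.mono_set (by rw [uIcc_of_le ht₁pos.le, uIcc_of_le ht₀pos.le]; gcongr)
  have i₀r : IntervalIntegrable (fun s => e s * (t₀ - s) ^ (a - 1)) volume t₁ t₀ :=
    i₀.mono_set (by rw [uIcc_of_le ht₁lt.le, uIcc_of_le ht₀pos.le]; gcongr)
  have hsplit := intervalIntegral.integral_add_adjacent_intervals i₀l i₀r
  -- The kernels are compared through `t₀ - s ≥ (t₀ / t₁) * (t₁ - s)` on `[0, t₁]`; the exponent `a
  -- - 1` is negative, hence the factor `q`.
  set q : ℝ := (t₀ / t₁) ^ (a - 1) with hq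
  have hleft : ∫ s in (0 : ℝ)..t₁, e s * (t₀ - s) ^ (a - 1)
      ≤ q * ∫ s in (0 : ℝ)..t₁, e s * (t₁ - s) ^ (a - 1) := by
    rw [← intervalIntegral.integral_const_mul]
    refine intervalIntegral.integral_mono_on_of_le_Ioo ht₁pos.le i₀l (i₁.const_mul q)
      fun s hs => ?_
    have hes : 0 < e s := by
      have := hpos s hs.1.le (hs.2.trans ht₁lt)
      have := hs.1
      simp only [he]; positivity
    have h1 : 0 < t₁ - s := by linarith [hs.2]
    have h2 : (t₀ - s) ^ (a - 1) ≤ q * (t₁ - s) ^ (a - 1) := by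
      rw [hq, ← Real.mul_rpow (by positivity) h1.le]
      refine Real.rpow_le_rpow_of_nonpos (by positivity) ?_ (by linarith [ha.2])
      rw [div_mul_eq_mul_div, div_le_iff₀ ht₁pos]
      nlinarith [hs.1]
    calc e s * (t₀ - s) ^ (a - 1) ≤ e s * (q * (t₁ - s) ^ (a - 1)) := by gcongr
      _ = _ := by ring
  have hrint : IntervalIntegrable (fun s => (t₀ - s) ^ (a - 1)) volume t₁ t₀ := by
    have := (intervalIntegral.intervalIntegrable_rpow' (a := t₀ - t₁) (b := 0)
      (by linarith [ha.1] : -1 < a - 1)).comp_sub_left t₀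
    simpa using this
  have hrval : ∫ s in t₁..t₀, (t₀ - s) ^ (a - 1) = (t₀ - t₁) ^ a / a := by
    rw [intervalIntegral.integral_comp_sub_left (fun s => s ^ (a - 1)), sub_self,
      integral_rpow (Or.inl (by linarith [ha.1]))]
    simp [Real.zero_rpow ha.1.ne']
  have hright : ∫ s in t₁..t₀, e s * (t₀ - s) ^ (a - 1) ≤ e t₁ * ((t₀ - t₁) ^ a / a) := by
    rw [← hrval, ← intervalIntegral.integral_const_mul]
    refine intervalIntegral.integral_mono_on_of_le_Ioo ht₁lt.le i₀r (hrint.const_mul _)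
      fun s hs => ?_
    have h1 : e s ≤ e t₁ := hmax ⟨by linarith [hs.1, ht₁.1], hs.2.le⟩
    have : 0 ≤ t₀ - s := by linarith [hs.2]
    gcongr
  have hqpos : 0 < q := by positivity
  have hqhalf : 1 / 2 ≤ q := by
    have e1 : q = (t₁ / t₀) ^ (1 - a) := by
      rw [hq, show a - 1 = -(1 - a) by ring, Real.rpow_neg (by positivity),
        ← Real.inv_rpow (by positivity), inv_div]
    have h2 : 1 / 2 ≤ t₁ / t₀ := by
      rw [le_div_iff₀ ht₀pos]; linarith [ht₁.1]
    have h3 : t₁ / t₀ ≤ 1 := (div_le_one ht₀pos).2 ht₁.2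
    rw [e1]
    refine h2.trans ?_
    calc t₁ / t₀ = (t₁ / t₀) ^ (1 : ℝ) := (Real.rpow_one _).symm
      _ ≤ _ := Real.rpow_le_rpow_of_exponent_ge (by positivity) h3 (by linarith [ha.1])
  -- This is where `b ≥ a` enters: the claim reduces to `t₁ ^ (b - a) ≤ t₀ ^ (b - a)`.
  have hqf : q * t₁ ^ (b - 1) ≤ t₀ ^ (b - 1) := by
    have e1 : t₀ ^ (b - 1) = t₀ ^ (a - 1) * t₀ ^ (b - a) := by
      rw [← Real.rpow_add ht₀pos]; ring_nf
    have e2 : t₁ ^ (b - 1) = t₁ ^ (a - 1) * t₁ ^ (b - a) := by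
      rw [← Real.rpow_add ht₁pos]; ring_nf
    rw [e1, e2, hq, Real.div_rpow ht₀pos.le ht₁pos.le, ← mul_assoc,
      div_mul_cancel₀ _ (by positivity)]
    have : 0 ≤ b - a := by linarith
    gcongr
  have hδ' : (t₀ - t₁) ^ a / a ≤ δ ^ a / a := by
    have := ha.1
    have : 0 ≤ t₀ - t₁ := by linarith
    gcongr
    linarith [ht₁.1]
  rw [v₁] at hleft
  rw [v₀] at hsplit
  have h5 : Real.Gamma a * (t₀ ^ (b - 1) / Real.Gamma b) ≤
      q * (Real.Gamma a * (t₁ ^ (b - 1) / Real.Gamma b - e t₁))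
        + e t₁ * ((t₀ - t₁) ^ a / a) := by
    nlinarith
  have h6 : Real.Gamma a * (q * t₁ ^ (b - 1) / Real.Gamma b)
      ≤ Real.Gamma a * (t₀ ^ (b - 1) / Real.Gamma b) := by gcongr
  have h7 : e t₁ * (q * Real.Gamma a) ≤ e t₁ * ((t₀ - t₁) ^ a / a) := by
    have : Real.Gamma a * (q * t₁ ^ (b - 1) / Real.Gamma b)
      = q * (Real.Gamma a * (t₁ ^ (b - 1) / Real.Gamma b)) := by ring
    nlinarith
  have h8 := le_of_mul_le_mul_left h7 het
  nlinarith

/-- `0 < E_{a,b}(-x) ≤ 1 / Γ(b)` for `x ≥ 0`, `a ∈ (0,1)` and `b ≥ a`. -/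
lemma abs_mittagLeffler_neg_le {a b : ℝ} (ha : a ∈ Ioo (0 : ℝ) 1) (hb : a ≤ b) {x : ℝ}
    (hx : 0 ≤ x) : |mittagLeffler a b (-x)| ≤ (Real.Gamma b)⁻¹ := by
  have hb0 : 0 < b := ha.1.trans_le hb
  rcases hx.eq_or_lt with rfl | hx
  · rw [neg_zero, mittagLeffler_zero, abs_of_pos (inv_pos.2 (Real.Gamma_pos_of_pos hb0))]
  set t : ℝ := x ^ a⁻¹ with ht
  have htpos : 0 < t := by positivity
  have hxt : x = t ^ a := by rw [ht, Real.rpow_inv_rpow hx.le ha.1.ne']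
  rw [hxt, abs_of_pos (mittagLeffler_neg_rpow_pos ha hb htpos.le)]
  have h1 := (mittagLeffler_volterra ha hb0 htpos).2
  -- The integral equals `Γ(a) * t ^ (b - 1) * (1 / Γ(b) - E_{a,b}(-t ^ a))`, so its sign is the
  -- upper bound.
  have h2 : 0 ≤ ∫ s in (0 : ℝ)..t,
      s ^ (b - 1) * mittagLeffler a b (-s ^ a) * (t - s) ^ (a - 1) := by
    refine intervalIntegral.integral_nonneg htpos.le fun s hs => ?_
    have := mittagLeffler_neg_rpow_pos ha hb hs.1
    have := hs.1
    have : 0 ≤ t - s := by linarith [hs.2]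
    positivity
  rw [h1] at h2
  have h3 := nonneg_of_mul_nonneg_right h2 (Real.Gamma_pos_of_pos ha.1)
  have hp : 0 < t ^ (b - 1) := by positivity
  rw [div_eq_mul_inv, ← mul_sub] at h3
  linarith [nonneg_of_mul_nonneg_right h3 hp]

section SolutionOperator

variable {H : Type*} [NormedAddCommGroup H] [InnerProductSpace ℝ H]

/-! ### The solution operators -/

/-- A bounded sequence defines a bounded diagonal operator. -/
lemma exists_diagonal_clm (φ : HilbertBasis ℕ ℝ H) (m : ℕ → ℝ) {C : ℝ} (hC : 0 ≤ C)
    (hm : ∀ k, |m k| ≤ C) :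
    ∃ G : H →L[ℝ] H, (∀ ψ, HasSum (fun k => (m k * ⟪ψ, φ k⟫_ℝ) • φ k) (G ψ)) ∧
      (∀ ψ, ‖G ψ‖ ≤ C * ‖ψ‖) ∧ ∀ ψ k, ⟪G ψ, φ k⟫_ℝ = m k * ⟪ψ, φ k⟫_ℝ := by
  have hK : ∀ k, ‖m k • ContinuousLinearMap.id ℝ ℝ‖ ≤ C := fun k => by
    rw [norm_smul]
    simpa using hm k
  set D := lp.mapCLM (𝕜 := ℝ) (E := fun _ : ℕ => ℝ) (F := fun _ : ℕ => ℝ) 2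
    (fun k => m k • ContinuousLinearMap.id ℝ ℝ) hC hK with hD
  have hDc : ∀ f k, (D f : ℕ → ℝ) k = m k * f k := fun f k => by simp [hD]
  refine ⟨(φ.repr.symm.toContinuousLinearEquiv : _ →L[ℝ] H) ∘L D ∘L
    (φ.repr.toContinuousLinearEquiv : H →L[ℝ] _), fun ψ => ?_, fun ψ => ?_, fun ψ k => ?_⟩
  · have := φ.hasSum_repr_symm (D (φ.repr ψ))
    simp only [hDc, HilbertBasis.repr_apply_apply, real_inner_comm ψ] at this
    exact this
  · change ‖φ.repr.symm (D (φ.repr ψ))‖ ≤ _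
    rw [LinearIsometryEquiv.norm_map]
    have h1 : ‖D‖ ≤ C := lp.norm_mapCLM_le ..
    calc ‖D (φ.repr ψ)‖ ≤ ‖D‖ * ‖φ.repr ψ‖ := D.le_opNorm _
      _ ≤ C * ‖ψ‖ := by rw [LinearIsometryEquiv.norm_map]; gcongr
  · change ⟪φ.repr.symm (D (φ.repr ψ)), φ k⟫_ℝ = _
    rw [real_inner_comm, ← HilbertBasis.repr_apply_apply, LinearIsometryEquiv.apply_symm_apply,
      hDc, HilbertBasis.repr_apply_apply, real_inner_comm]

/-- The `k`-th eigenvalue of `S_η(t)`. -/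
def solSymbol (lam : ℕ → ℝ) (α β η : ℝ) (k : ℕ) (t : ℝ) : ℝ :=
  t ^ (α + η - 1) * mittagLeffler α (α + η) (-(lam k ^ β) * t ^ α)

variable {lam : ℕ → ℝ} {α β η : ℝ}

lemma measurable_solSymbol (hα : α ∈ Ioo (0 : ℝ) 1) (hη : 0 ≤ η) (k : ℕ) :
    Measurable (solSymbol lam α β η k) := by
  have h := (continuous_mittagLeffler (b := α + η) hα (by linarith [hα.1])).measurable
  exact (measurable_id.pow_const _).mul
    (h.comp ((measurable_id.pow_const _).const_mul (-(lam k ^ β))))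

/-- The bound is uniform in the eigenvalue. It includes `t = 0`, where a negative power is `0` by
convention and both sides vanish. -/
lemma abs_solSymbol_le (hlam : ∀ k, 0 ≤ lam k) (hα : α ∈ Ioo (0 : ℝ) 1) (hη : 0 ≤ η) (k : ℕ)
    {t : ℝ} (ht : 0 ≤ t) :
    |solSymbol lam α β η k t| ≤ (Real.Gamma (α + η))⁻¹ * t ^ (α + η - 1) := by
  have h := abs_mittagLeffler_neg_le hα (by linarith : α ≤ α + η)
    (mul_nonneg (Real.rpow_nonneg (hlam k) β) (Real.rpow_nonneg ht α))
  rw [solSymbol, abs_mul, abs_of_nonneg (Real.rpow_nonneg ht _), mul_comm, neg_mul]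
  gcongr

lemma exists_solOp_clm (hlam : ∀ k, 0 ≤ lam k) (φ : HilbertBasis ℕ ℝ H)
    (hα : α ∈ Ioo (0 : ℝ) 1) (hη : 0 ≤ η) {t : ℝ} (ht : 0 ≤ t) :
    ∃ G : H →L[ℝ] H,
      (∀ ψ, HasSum (fun k => (solSymbol lam α β η k t * ⟪ψ, φ k⟫_ℝ) • φ k) (G ψ)) ∧
      (∀ ψ, ‖G ψ‖ ≤ (Real.Gamma (α + η))⁻¹ * t ^ (α + η - 1) * ‖ψ‖) ∧
      (∀ ψ k, ⟪G ψ, φ k⟫_ℝ = solSymbol lam α β η k t * ⟪ψ, φ k⟫_ℝ) ∧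
      ∀ ψ, solOp lam φ α β η t ψ = G ψ := by
  have hG : 0 < Real.Gamma (α + η) := Real.Gamma_pos_of_pos (by linarith [hα.1])
  obtain ⟨G, h1, h2, h3⟩ := exists_diagonal_clm φ (fun k => solSymbol lam α β η k t)
    (C := (Real.Gamma (α + η))⁻¹ * t ^ (α + η - 1)) (by positivity)
    fun k => abs_solSymbol_le hlam hα hη k ht
  refine ⟨G, h1, h2, h3, fun ψ => ?_⟩
  rw [solOp, ← (h1 ψ).tsum_eq]
  rcases eq_or_ne (t ^ (α + η - 1)) 0 with h0 | h0
  · simp [solSymbol, h0]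
  · rw [← tsum_const_smul'' (t ^ (α + η - 1))]
    simp only [solSymbol, smul_smul, mul_assoc]

lemma solOp_sub (hlam : ∀ k, 0 ≤ lam k) (φ : HilbertBasis ℕ ℝ H) (hα : α ∈ Ioo (0 : ℝ) 1)
    (hη : 0 ≤ η) {t : ℝ} (ht : 0 ≤ t) (u w : H) :
    solOp lam φ α β η t (u - w) = solOp lam φ α β η t u - solOp lam φ α β η t w := by
  obtain ⟨G, -, -, -, h⟩ := exists_solOp_clm (β := β) hlam φ hα hη ht
  simp [h]

lemma continuous_solOp (hlam : ∀ k, 0 ≤ lam k) (φ : HilbertBasis ℕ ℝ H)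
    (hα : α ∈ Ioo (0 : ℝ) 1) (hη : 0 ≤ η) {t : ℝ} (ht : 0 ≤ t) :
    Continuous (solOp lam φ α β η t) := by
  obtain ⟨G, -, -, -, h⟩ := exists_solOp_clm (β := β) hlam φ hα hη ht
  rw [funext h]
  exact G.continuous

lemma norm_solOp_le (hlam : ∀ k, 0 ≤ lam k) (φ : HilbertBasis ℕ ℝ H) (hα : α ∈ Ioo (0 : ℝ) 1)
    (hη : 0 ≤ η) {t : ℝ} (ht : 0 ≤ t) (ψ : H) :
    ‖solOp lam φ α β η t ψ‖ ≤ (Real.Gamma (α + η))⁻¹ * t ^ (α + η - 1) * ‖ψ‖ := by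
  obtain ⟨G, -, h', -, h⟩ := exists_solOp_clm (β := β) hlam φ hα hη ht
  rw [h]
  exact h' ψ

lemma inner_solOp (hlam : ∀ k, 0 ≤ lam k) (φ : HilbertBasis ℕ ℝ H) (hα : α ∈ Ioo (0 : ℝ) 1)
    (hη : 0 ≤ η) {t : ℝ} (ht : 0 ≤ t) (ψ : H) (k : ℕ) :
    ⟪solOp lam φ α β η t ψ, φ k⟫_ℝ = solSymbol lam α β η k t * ⟪ψ, φ k⟫_ℝ := by
  obtain ⟨G, -, -, h', h⟩ := exists_solOp_clm (β := β) hlam φ hα hη ht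
  rw [h]
  exact h' ψ k

/-- The partial sums of the eigenfunction expansion are measurable coordinate by coordinate and
converge pointwise, so no continuity of `t ↦ S_η(t)` is needed. -/
lemma aestronglyMeasurable_solOp (hlam : ∀ k, 0 ≤ lam k) (φ : HilbertBasis ℕ ℝ H)
    (hα : α ∈ Ioo (0 : ℝ) 1) (hη : 0 ≤ η) {μ : Measure ℝ} {τ : ℝ → ℝ} {v : ℝ → H}
    (hτ : Measurable τ) (hτ0 : ∀ᵐ s ∂μ, 0 ≤ τ s) (hv : AEStronglyMeasurable v μ) :
    AEStronglyMeasurable (fun s => solOp lam φ α β η (τ s) (v s)) μ := by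
  refine aestronglyMeasurable_of_tendsto_ae atTop
    (f := fun n s => ∑ k ∈ Finset.range n,
      (solSymbol lam α β η k (τ s) * ⟪v s, φ k⟫_ℝ) • φ k) (fun n => ?_) ?_
  · refine Finset.aestronglyMeasurable_fun_sum _ fun k _ => ?_
    exact ((((measurable_solSymbol hα hη k).comp hτ).aestronglyMeasurable).mul
      (hv.inner aestronglyMeasurable_const)).smul_const _
  · filter_upwards [hτ0] with s hs
    obtain ⟨G, h1, -, -, h⟩ := exists_solOp_clm (β := β) hlam φ hα hη hs
    rw [h]
    exact (h1 (v s)).tendsto_sum_nat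

/-! ### Integrability of the weakly singular kernels. -/

lemma intervalIntegrable_sub_rpow {p : ℝ} (hp : -1 < p) (t : ℝ) :
    IntervalIntegrable (fun s => (t - s) ^ p) volume 0 t := by
  have := ((intervalIntegral.intervalIntegrable_rpow' (a := 0) (b := t) hp).comp_sub_left t).symm
  simpa using this

lemma integral_sub_rpow {p : ℝ} (hp : 0 < p) (t : ℝ) :
    ∫ s in (0 : ℝ)..t, (t - s) ^ (p - 1) = t ^ p / p := by
  rw [intervalIntegral.integral_comp_sub_left (fun s => s ^ (p - 1)), sub_self, sub_zero,
    integral_rpow (Or.inl (by linarith))]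
  simp [Real.zero_rpow hp.ne']

lemma ae_restrict_Ioc_sub_nonneg (t : ℝ) : ∀ᵐ s ∂volume.restrict (Ioc 0 t), 0 ≤ t - s := by
  filter_upwards [ae_restrict_mem measurableSet_Ioc] with s hs
  linarith [hs.2]

lemma intervalIntegrable_solOp_of_bounded (hlam : ∀ k, 0 ≤ lam k) (φ : HilbertBasis ℕ ℝ H)
    (hα : α ∈ Ioo (0 : ℝ) 1) (hη : 0 ≤ η) {t : ℝ} (ht : 0 ≤ t) {g : ℝ → H} {K : ℝ}
    (hg : AEStronglyMeasurable g (volume.restrict (Ioc 0 t))) (hK : ∀ s, ‖g s‖ ≤ K) :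
    IntervalIntegrable (fun s => solOp lam φ α β η (t - s) (g s)) volume 0 t := by
  have hG : 0 < Real.Gamma (α + η) := Real.Gamma_pos_of_pos (by linarith [hα.1])
  rw [intervalIntegrable_iff_integrableOn_Ioc_of_le ht]
  refine Integrable.mono' (((intervalIntegrable_iff_integrableOn_Ioc_of_le ht).1
    (intervalIntegrable_sub_rpow (p := α + η - 1) (by linarith [hα.1]) t)).const_mul
      ((Real.Gamma (α + η))⁻¹ * K))
    (aestronglyMeasurable_solOp hlam φ hα hη (measurable_const.sub measurable_id)
      (ae_restrict_Ioc_sub_nonneg t) hg) ?_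
  filter_upwards [ae_restrict_Ioc_sub_nonneg t] with s hs
  refine (norm_solOp_le hlam φ hα hη hs _).trans ?_
  calc _ ≤ (Real.Gamma (α + η))⁻¹ * (t - s) ^ (α + η - 1) * K := by gcongr; exact hK s
    _ = _ := by ring

/-- With `p = α + γ - 1` the threshold `-1/2 < p` is the condition `α + γ > 1/2`. -/
lemma memLp_two_sub_rpow {p : ℝ} (hp : -(1 / 2) < p) {t : ℝ} (ht : 0 ≤ t) :
    MemLp (fun s => (t - s) ^ p) 2 (volume.restrict (Ioc 0 t)) := by
  have hm : Measurable fun s : ℝ => (t - s) ^ p := (measurable_id.const_sub t).pow_const p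
  rw [memLp_two_iff_integrable_sq hm.aestronglyMeasurable]
  have h := (intervalIntegrable_iff_integrableOn_Ioc_of_le ht).1
    (intervalIntegrable_sub_rpow (p := p * 2) (by linarith) t)
  refine h.congr ?_
  filter_upwards [ae_restrict_Ioc_sub_nonneg t] with s hs
  rw [Real.rpow_mul hs, Real.rpow_ofNat]

lemma intervalIntegrable_solOp_of_memLp (hlam : ∀ k, 0 ≤ lam k) (φ : HilbertBasis ℕ ℝ H)
    (hα : α ∈ Ioo (0 : ℝ) 1) (hη : 0 ≤ η) (hαη : 1 / 2 < α + η) {t : ℝ} (ht : 0 ≤ t)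
    {v : ℝ → H} (hv : MemLp v 2 (volume.restrict (Ioc 0 t))) :
    IntervalIntegrable (fun s => solOp lam φ α β η (t - s) (v s)) volume 0 t := by
  have hG : 0 < Real.Gamma (α + η) := Real.Gamma_pos_of_pos (by linarith [hα.1])
  rw [intervalIntegrable_iff_integrableOn_Ioc_of_le ht]
  refine Integrable.mono' (((memLp_two_sub_rpow (p := α + η - 1) (by linarith) ht).integrable_mul
      hv.norm).const_mul (Real.Gamma (α + η))⁻¹)
    (aestronglyMeasurable_solOp hlam φ hα hη (measurable_const.sub measurable_id)
      (ae_restrict_Ioc_sub_nonneg t) hv.1) ?_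
  filter_upwards [ae_restrict_Ioc_sub_nonneg t] with s hs
  refine (norm_solOp_le hlam φ hα hη hs _).trans (le_of_eq ?_)
  simp only [Pi.mul_apply]
  ring

end SolutionOperator

section WeakLimits

variable {H : Type*} [NormedAddCommGroup H] [InnerProductSpace ℝ H]

/-! ### Lipschitz continuity of the drift, weak limits, controls -/

/-- The mean value inequality on the segment from `w` to `u` only uses the derivative in the
direction `u - w`, so Gâteaux differentiability suffices. -/
lemma DriftAssumption.exists_lipschitz {F : H → H} (hF : DriftAssumption F) :
    ∃ L > 0, (∀ u, ‖F u‖ ≤ L * (1 + ‖u‖)) ∧ ∀ u w, ‖F u - F w‖ ≤ L * ‖u - w‖ := by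
  obtain ⟨L, hL, hgrow, F', hF', hb⟩ := hF
  refine ⟨L, hL, hgrow, fun u w => ?_⟩
  have hd : ∀ τ : ℝ, HasDerivAt (fun τ : ℝ => F (w + τ • (u - w)))
      (F' (w + τ • (u - w)) (u - w)) τ := by
    intro τ
    have h := hF' (w + τ • (u - w)) (u - w)
    have h2 : HasDerivAt (fun r : ℝ => F (w + τ • (u - w) + r • (u - w)))
      (F' (w + τ • (u - w)) (u - w)) (τ - τ) := by rwa [sub_self]
    refine (h2.comp_sub_const τ τ).congr_of_eventuallyEq (Eventually.of_forall fun r => ?_)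
    simp only
    congr 1
    module
  have := norm_image_sub_le_of_norm_deriv_le_segment_01' (C := L * ‖u - w‖)
    (fun τ _ => (hd τ).hasDerivWithinAt) fun τ _ => hb _ _
  simpa using this

variable [CompleteSpace H]

/-- Bounded sequences in a Hilbert space converge weakly along ultrafilters. -/
lemma exists_weak_limit (U : Ultrafilter ℕ) (w : ℕ → H) {r : ℝ}
    (hw : ∀ r' > r, ∀ᶠ n in (U : Filter ℕ), ‖w n‖ ≤ r') :
    ∃ w₀ : H, ‖w₀‖ ≤ r ∧ ∀ g, Tendsto (fun n => ⟪w n, g⟫_ℝ) U (𝓝 ⟪w₀, g⟫_ℝ) := by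
  -- Banach–Alaoglu, transported to `H` by the Riesz isomorphism.
  have hK := WeakDual.isCompact_closedBall (𝕜 := ℝ) (E := H) 0 (r + 1)
  set f : ℕ → WeakDual ℝ H := fun n =>
    WeakDual.toStrongDual.symm (InnerProductSpace.toDual ℝ H (w n)) with hf
  have hmem : ∀ᶠ n in (U : Filter ℕ), f n ∈
      WeakDual.toStrongDual (𝕜 := ℝ) (E := H) ⁻¹' Metric.closedBall 0 (r + 1) := by
    filter_upwards [hw (r + 1) (by linarith)] with n hn
    simpa [hf] using hn
  obtain ⟨f₀, -, hlim⟩ := hK.ultrafilter_le_nhds (U.map f) (le_principal_iff.2 hmem)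
  have hweak : ∀ g, Tendsto (fun n => ⟪w n, g⟫_ℝ) U
      (𝓝 ⟪(InnerProductSpace.toDual ℝ H).symm (WeakDual.toStrongDual f₀), g⟫_ℝ) := fun g => by
    have h1 : Tendsto f U (𝓝 f₀) := hlim
    have h2 := ((WeakDual.eval_continuous (𝕜 := ℝ) g).tendsto f₀).comp h1
    simpa [hf, Function.comp_def] using h2
  refine ⟨_, le_of_forall_gt_imp_ge_of_dense fun r' hr' => ?_, hweak⟩
  set w₀ := (InnerProductSpace.toDual ℝ H).symm (WeakDual.toStrongDual f₀)
  -- Weak lower semicontinuity of the norm: the weak limit is tested against itself.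
  have h1 : ⟪w₀, w₀⟫_ℝ ≤ r' * ‖w₀‖ := by
    refine le_of_tendsto (hweak w₀) ?_
    filter_upwards [hw r' hr'] with n hn
    exact (real_inner_le_norm _ _).trans (by gcongr)
  rw [real_inner_self_eq_norm_sq, sq] at h1
  rcases (norm_nonneg w₀).eq_or_lt with h0 | h0
  · obtain ⟨n, hn⟩ := (hw r' hr').exists
    rw [← h0]
    exact (norm_nonneg _).trans hn
  · exact le_of_mul_le_mul_right h1 h0

lemma pinv_apply (R : H →L[ℝ] H) [(LinearMap.ker (R : H →ₗ[ℝ] H)).HasOrthogonalProjection]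
    (w : H) : pinv R (R w) = (LinearMap.ker (R : H →ₗ[ℝ] H))ᗮ.starProjection w := by
  obtain ⟨h1, h2⟩ := pinv_spec R ⟨w, rfl⟩
  refine (Submodule.eq_starProjection_of_mem_of_inner_eq_zero h1 fun z hz => ?_).symm
  refine Submodule.inner_right_of_mem_orthogonal (K := LinearMap.ker (R : H →ₗ[ℝ] H)) ?_ hz
  simp [h2]

/-- On vectors of the form `R w` the pseudo-inverse gives the orthogonal projection of `w` onto
`(ker R)ᗮ`. Hence for `w` square integrable, `s ↦ R (w s)` is a control with energy at most that of
`w`. -/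
lemma exists_pinv_clm (R : H →L[ℝ] H) :
    ∃ P : H →L[ℝ] H, (∀ w, pinv R (R w) = P w) ∧ ∀ w, ‖P w‖ ≤ ‖w‖ := by
  have : CompleteSpace (LinearMap.ker (R : H →ₗ[ℝ] H)) := R.isClosed_ker.completeSpace_coe
  exact ⟨(LinearMap.ker (R : H →ₗ[ℝ] H))ᗮ.starProjection, pinv_apply R,
    fun w => Submodule.norm_starProjection_apply_le _ w⟩

lemma lintegral_enorm_sq_eq {X E : Type*} [MeasurableSpace X] [NormedAddCommGroup E]
    {μ : Measure X} {f : X → E}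
    (hf : MemLp f 2 μ) :
    ∫⁻ s, ‖f s‖ₑ ^ 2 ∂μ = ENNReal.ofReal (‖hf.toLp f‖ ^ 2) := by
  rw [Lp.norm_toLp, ENNReal.ofReal_pow ENNReal.toReal_nonneg, ENNReal.ofReal_toReal hf.2.ne]
  have := eLpNorm_nnreal_pow_eq_lintegral (f := f) (μ := μ) (p := 2) (by norm_num)
  simpa using this.symm

/-- The integrand tested against `φ k` is the inner product of `w s` with `solSymbol lam α β γ k (t
- s) • R (φ k)`, a square integrable function of `s`. The representer is independent of `w`, so weak
convergence of `w` passes to the control integral. -/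
lemma exists_representer {lam : ℕ → ℝ} {α β γ : ℝ} (hlam : ∀ k, 0 ≤ lam k)
    (φ : HilbertBasis ℕ ℝ H) (hα : α ∈ Ioo (0 : ℝ) 1) (hγ : 0 ≤ γ) (hαγ : 1 / 2 < α + γ)
    {R : H →L[ℝ] H} (hR : ∀ u w, ⟪R u, w⟫_ℝ = ⟪u, R w⟫_ℝ) {T t : ℝ} (ht : t ∈ Icc 0 T) (k : ℕ) :
    ∃ g : Lp H 2 (volume.restrict (Icc 0 T)), ∀ (w v : ℝ → H)
      (hw : MemLp w 2 (volume.restrict (Icc 0 T))), (∀ s ∈ Icc 0 T, v s = R (w s)) →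
      ⟪∫ s in (0 : ℝ)..t, solOp lam φ α β γ (t - s) (v s), φ k⟫_ℝ = ⟪hw.toLp w, g⟫_ℝ := by
  set μ := volume.restrict (Icc 0 T) with hμ
  have hsub : Ioc 0 t ⊆ Icc 0 T := fun s hs => ⟨hs.1.le, hs.2.trans ht.2⟩
  set G : ℝ → H := (Ioc 0 t).indicator fun s => solSymbol lam α β γ k (t - s) • R (φ k) with hG
  have hGl : MemLp G 2 μ := by
    rw [hG, memLp_indicator_iff_restrict measurableSet_Ioc, hμ,
      Measure.restrict_restrict_of_subset hsub]
    have hm : MemLp (fun s => solSymbol lam α β γ k (t - s)) 2 (volume.restrict (Ioc 0 t)) := by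
      refine ((memLp_two_sub_rpow (p := α + γ - 1) (by linarith) ht.1).const_mul
        (Real.Gamma (α + γ))⁻¹).mono'
        ((measurable_solSymbol hα hγ k).comp (measurable_id.const_sub t)).aestronglyMeasurable ?_
      filter_upwards [ae_restrict_Ioc_sub_nonneg t] with s hs
      exact abs_solSymbol_le hlam hα hγ k hs
    exact ((ContinuousLinearMap.id ℝ ℝ).smulRight (R (φ k))).comp_memLp' hm
  refine ⟨hGl.toLp G, fun w v hw hv => ?_⟩
  have hvt : MemLp v 2 (volume.restrict (Ioc 0 t)) := by
    have h1 : MemLp (fun s => R (w s)) 2 (volume.restrict (Ioc 0 t)) :=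
      R.comp_memLp' (hw.mono_measure (Measure.restrict_mono hsub le_rfl))
    refine (memLp_congr_ae ?_).1 h1
    filter_upwards [ae_restrict_mem measurableSet_Ioc] with s hs
    exact (hv s (hsub hs)).symm
  have hint := intervalIntegrable_solOp_of_memLp (β := β) hlam φ hα hγ hαγ ht.1 hvt
  rw [intervalIntegrable_iff_integrableOn_Ioc_of_le ht.1] at hint
  rw [real_inner_comm, intervalIntegral.integral_of_le ht.1, ← integral_inner hint, L2.inner_def]
  have e1 : ∫ s, ⟪(hw.toLp w) s, (hGl.toLp G) s⟫_ℝ ∂μ = ∫ s, (Ioc 0 t).indicator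
      (fun s => ⟪φ k, solOp lam φ α β γ (t - s) (v s)⟫_ℝ) s ∂μ := by
    refine integral_congr_ae ?_
    filter_upwards [hw.coeFn_toLp, hGl.coeFn_toLp] with s h1 h2
    rw [h1, h2, hG]
    by_cases hs : s ∈ Ioc 0 t
    · rw [indicator_of_mem hs, indicator_of_mem hs, real_inner_comm _ (φ k),
        inner_solOp hlam φ hα hγ (by linarith [hs.2]), hv s (hsub hs), hR, inner_smul_right]
    · rw [indicator_of_notMem hs, indicator_of_notMem hs, inner_zero_right]
  rw [e1, integral_indicator measurableSet_Ioc, hμ, Measure.restrict_restrict_of_subset hsub]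

end WeakLimits

section Skeleton

variable {H : Type*} [NormedAddCommGroup H]

/-! ### The drift convolution and the closedness of the skeleton equation -/

lemma continuous_of_lipschitz_bound {F : H → H} {L : ℝ}
    (hF : ∀ u w, ‖F u - F w‖ ≤ L * ‖u - w‖) : Continuous F := by
  refine (LipschitzWith.of_dist_le_mul (K := L.toNNReal) fun u w => ?_).continuous
  rw [dist_eq_norm, dist_eq_norm]
  refine (hF u w).trans ?_
  gcongr
  exact Real.le_coe_toNNReal L

lemma stronglyMeasurable_drift {F : H → H} (hF : Continuous F) {T : ℝ} (hT : 0 < T)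
    {ρ : ℝ → ℝ} (hρ : Measurable ρ) (z : C(Icc (0 : ℝ) T, H)) :
    StronglyMeasurable fun s => F (IccExtend hT.le z (ρ s)) :=
  (hF.comp (z.continuous.Icc_extend')).comp_stronglyMeasurable hρ.stronglyMeasurable

lemma norm_drift_le {F : H → H} {L : ℝ} (hL : 0 < L) (hF : ∀ u, ‖F u‖ ≤ L * (1 + ‖u‖)) {T : ℝ}
    (hT : 0 < T) (z : C(Icc (0 : ℝ) T, H)) (r : ℝ) :
    ‖F (IccExtend hT.le z r)‖ ≤ L * (1 + ‖z‖) := by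
  refine (hF _).trans ?_
  gcongr
  exact z.norm_coe_le_norm _

variable [InnerProductSpace ℝ H]

lemma norm_integral_solOp_zero_le {lam : ℕ → ℝ} {α β : ℝ} (hlam : ∀ k, 0 ≤ lam k)
    (φ : HilbertBasis ℕ ℝ H) (hα : α ∈ Ioo (0 : ℝ) 1) {t : ℝ} (ht : 0 ≤ t) {g : ℝ → H}
    {b : ℝ → ℝ} (hb : Continuous b) (hg : ∀ s ∈ Ioc 0 t, ‖g s‖ ≤ b s) :
    ‖∫ s in (0 : ℝ)..t, solOp lam φ α β 0 (t - s) (g s)‖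
      ≤ (Real.Gamma α)⁻¹ * ∫ s in (0 : ℝ)..t, (t - s) ^ (α - 1) * b s := by
  have hG : 0 < Real.Gamma α := Real.Gamma_pos_of_pos hα.1
  rw [← intervalIntegral.integral_const_mul]
  refine intervalIntegral.norm_integral_le_of_norm_le ht (Eventually.of_forall fun s hs => ?_)
    (((intervalIntegrable_sub_rpow (by linarith [hα.1]) t).mul_continuousOn
      hb.continuousOn).const_mul _)
  have h0 : 0 ≤ t - s := by linarith [hs.2]
  refine (norm_solOp_le hlam φ hα le_rfl h0 _).trans ?_
  rw [add_zero, mul_assoc]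
  gcongr
  exact hg s hs

lemma integral_solOp_zero_sub {lam : ℕ → ℝ} {α β : ℝ} (hlam : ∀ k, 0 ≤ lam k)
    (φ : HilbertBasis ℕ ℝ H) (hα : α ∈ Ioo (0 : ℝ) 1) {t : ℝ} (ht : 0 ≤ t) {g₁ g₂ : ℝ → H}
    {K : ℝ} (hg₁ : StronglyMeasurable g₁) (hg₂ : StronglyMeasurable g₂)
    (hK₁ : ∀ s, ‖g₁ s‖ ≤ K) (hK₂ : ∀ s, ‖g₂ s‖ ≤ K) :
    ∫ s in (0 : ℝ)..t, solOp lam φ α β 0 (t - s) (g₁ s - g₂ s)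
      = (∫ s in (0 : ℝ)..t, solOp lam φ α β 0 (t - s) (g₁ s))
        - ∫ s in (0 : ℝ)..t, solOp lam φ α β 0 (t - s) (g₂ s) := by
  rw [← intervalIntegral.integral_sub
    (intervalIntegrable_solOp_of_bounded hlam φ hα le_rfl ht hg₁.aestronglyMeasurable hK₁)
    (intervalIntegrable_solOp_of_bounded hlam φ hα le_rfl ht hg₂.aestronglyMeasurable hK₂)]
  refine intervalIntegral.integral_congr fun s hs => ?_
  rw [uIcc_of_le ht] at hs
  exact solOp_sub hlam φ hα le_rfl (by linarith [hs.2]) _ _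

variable [CompleteSpace H]

/-- Limits along an ultrafilter of skeleton solutions with controls of bounded energy. -/
theorem exists_control_of_tendsto {lam : ℕ → ℝ} {α β γ : ℝ} (hlam : ∀ k, 0 ≤ lam k)
    (φ : HilbertBasis ℕ ℝ H) (hα : α ∈ Ioo (0 : ℝ) 1) (hγ : 0 ≤ γ) (hαγ : 1 / 2 < α + γ)
    {F : H → H} (hF : DriftAssumption F) {Q : H →L[ℝ] H} (hQ : Q.IsPositive) (x₀ : H) {T : ℝ}
    (hT : 0 < T) (U : Ultrafilter ℕ) {ρ : ℕ → ℝ → ℝ} (hρ : ∀ n, Measurable (ρ n))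
    {y : ℕ → C(Icc (0 : ℝ) T, H)} {x : C(Icc (0 : ℝ) T, H)} (hyx : Tendsto y U (𝓝 x))
    (hyρ : ∀ e > 0, ∀ᶠ n in (U : Filter ℕ), ∀ s ∈ Icc 0 T,
      ‖IccExtend hT.le (y n) (ρ n s) - IccExtend hT.le x s‖ ≤ e)
    {v : ℕ → ℝ → H} {r : ℝ} (hr : 0 ≤ r)
    (hv : ∀ᶠ n in (U : Filter ℕ), IsControl Q T (v n) ∧
      IsSkeletonSolution lam φ α β γ F x₀ hT (ρ n) (v n) (y n))
    (hvr : ∀ r' > r, ∀ᶠ n in (U : Filter ℕ),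
      ∫⁻ s in Icc 0 T, normH0 Q (v n s) ^ 2 ≤ ENNReal.ofReal (r' ^ 2)) :
    ∃ u : ℝ → H, IsControl Q T u ∧ IsSkeletonSolution lam φ α β γ F x₀ hT id u x ∧
      ∫⁻ s in Icc 0 T, normH0 Q (u s) ^ 2 ≤ ENNReal.ofReal (r ^ 2) := by
  classical
  obtain ⟨L, hL, hFg, hFl⟩ := hF.exists_lipschitz
  have hFc := continuous_of_lipschitz_bound hFl
  set R := posSqrt Q with hR
  have hRs : ∀ u w, ⟪R u, w⟫_ℝ = ⟪u, R w⟫_ℝ := fun u w => (posSqrt_spec hQ).1.1 u w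
  set μ := volume.restrict (Icc 0 T) with hμ
  -- The controls are lifted to `L²([0,T], H)` by `Q^{-1/2}`; the value `0` serves the indices
  -- outside the eventual set.
  set w : ℕ → Lp H 2 μ := fun n =>
    if h : IsControl Q T (v n) then h.2.toLp _ else 0 with hw
  have hwr : ∀ r' > r, ∀ᶠ n in (U : Filter ℕ), ‖w n‖ ≤ r' := by
    intro r' hr'
    filter_upwards [hv, hvr r' hr'] with n hn h3
    obtain ⟨h1, -⟩ := hn
    have h4 := lintegral_enorm_sq_eq h1.2
    simp only [normH0] at h3
    rw [h4, ENNReal.ofReal_le_ofReal_iff (sq_nonneg r')] at h3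
    simp only [hw, dif_pos h1]
    exact le_of_sq_le_sq h3 (hr.trans hr'.le)
  obtain ⟨w₀, hw₀, hlim⟩ := exists_weak_limit U w hwr
  obtain ⟨P, hP, hPn⟩ := exists_pinv_clm R
  have hw₀m : MemLp w₀ 2 μ := Lp.memLp w₀
  refine ⟨fun s => R (w₀ s), ⟨fun s _ => ⟨w₀ s, rfl⟩, ?_⟩, ?_, ?_⟩
  · simp only [← hR, hP]
    exact P.comp_memLp' hw₀m
  · rintro ⟨t, ht⟩
    -- Only weak convergence of the control integral is available, so the limit equation is checked
    -- on each coordinate.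
    refine φ.repr.injective (lp.ext (funext fun k => ?_))
    rw [HilbertBasis.repr_apply_apply, HilbertBasis.repr_apply_apply, real_inner_comm,
      real_inner_comm _ (φ k)]
    obtain ⟨g, hg⟩ := exists_representer (β := β) hlam φ hα hγ hαγ hRs ht k
    have hB := hg w₀ (fun s => R (w₀ s)) hw₀m fun s _ => rfl
    rw [Lp.toLp_coeFn] at hB
    set A : ℕ → H := fun n =>
      ∫ s in (0 : ℝ)..t, solOp lam φ α β 0 (t - s) (F (IccExtend hT.le (y n) (ρ n s))) with hA
    set A₀ : H := ∫ s in (0 : ℝ)..t, solOp lam φ α β 0 (t - s) (F (IccExtend hT.le x (id s)))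
      with hA₀
    have hAlim : Tendsto A U (𝓝 A₀) := by
      rw [Metric.tendsto_nhds]
      intro e he
      have hG : 0 < Real.Gamma α := Real.Gamma_pos_of_pos hα.1
      set c := (Real.Gamma α)⁻¹ * (L * (t ^ α / α)) with hc
      have hc0 : 0 ≤ c := by
        have := hα.1
        have := ht.1
        positivity
      -- Here `c` vanishes when `t = 0`; dividing by `c + 1` avoids a case distinction and leaves `c
      -- / (c + 1) < 1`.
      filter_upwards [hyρ (e / (c + 1)) (by positivity)] with n hn
      have hKn := norm_drift_le hL hFg hT (y n)
      have hKx := norm_drift_le hL hFg hT x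
      rw [dist_eq_norm, hA, hA₀, ← integral_solOp_zero_sub hlam φ hα ht.1
        (K := max (L * (1 + ‖y n‖)) (L * (1 + ‖x‖)))
        (stronglyMeasurable_drift hFc hT (hρ n) (y n))
        (stronglyMeasurable_drift hFc hT measurable_id x)
        (fun s => (hKn _).trans (le_max_left _ _)) (fun s => (hKx _).trans (le_max_right _ _))]
      refine (norm_integral_solOp_zero_le hlam φ hα ht.1
        (b := fun _ => L * (e / (c + 1))) continuous_const fun s hs => ?_).trans_lt ?_
      · refine (hFl _ _).trans ?_
        gcongr
        exact hn s ⟨hs.1.le, hs.2.trans ht.2⟩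
      · rw [intervalIntegral.integral_mul_const, integral_sub_rpow hα.1]
        calc _ = c / (c + 1) * e := by rw [hc]; ring
          _ < 1 * e := by
            gcongr
            rw [div_lt_one (by positivity)]
            linarith
          _ = e := one_mul e
    have h1 : Tendsto (fun n => ⟪y n ⟨t, ht⟩, φ k⟫_ℝ) U (𝓝 ⟪x ⟨t, ht⟩, φ k⟫_ℝ) :=
      (((continuous_eval_const (⟨t, ht⟩ : Icc (0 : ℝ) T)).tendsto x).comp hyx).inner
        tendsto_const_nhds
    have h2 : Tendsto (fun n => ⟪solOp lam φ α β (1 - α) t x₀ + A n, φ k⟫_ℝ + ⟪w n, g⟫_ℝ) U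
        (𝓝 (⟪solOp lam φ α β (1 - α) t x₀ + A₀, φ k⟫_ℝ + ⟪w₀, g⟫_ℝ)) :=
      ((tendsto_const_nhds.add hAlim).inner tendsto_const_nhds).add (hlim g)
    rw [inner_add_left, hB]
    refine tendsto_nhds_unique (h1.congr' ?_) h2
    filter_upwards [hv] with n hn
    obtain ⟨hn1, hn2⟩ := hn
    rw [hn2 ⟨t, ht⟩, inner_add_left, hg _ (v n) hn1.2 fun s hs =>
      (pinv_spec R (hn1.1 s hs)).2.symm]
    simp only [hw, dif_pos hn1, hA]
  · have h1 : ∫⁻ s in Icc 0 T, ‖w₀ s‖ₑ ^ 2 = ENNReal.ofReal (‖w₀‖ ^ 2) := by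
      have := lintegral_enorm_sq_eq hw₀m
      rwa [Lp.toLp_coeFn] at this
    -- The projection can only decrease the energy, so it need not be shown that `w₀` takes values
    -- orthogonal to `ker R`.
    calc ∫⁻ s in Icc 0 T, normH0 Q (R (w₀ s)) ^ 2 ≤ ∫⁻ s in Icc 0 T, ‖w₀ s‖ₑ ^ 2 := by
          refine lintegral_mono fun s => ?_
          simp only [normH0, ← hR, hP]
          gcongr
          exact enorm_le_iff_norm_le.2 (hPn _)
      _ ≤ _ := by
          rw [h1]
          gcongr

end Skeleton

/-! ### The grid -/

lemma measurable_gridFloor (h : ℝ) : Measurable (gridFloor h) := by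
  have : Measurable fun s : ℝ => (⌊s / h⌋ : ℝ) :=
    (measurable_of_countable fun n : ℤ => (n : ℝ)).comp
      (Int.measurable_floor.comp (measurable_id.div_const h))
  exact this.const_mul h

lemma gridFloor_nonneg {h s : ℝ} (hh : 0 < h) (hs : 0 ≤ s) : 0 ≤ gridFloor h s := by
  have : (0 : ℤ) ≤ ⌊s / h⌋ := Int.floor_nonneg.2 (by positivity)
  have : (0 : ℝ) ≤ ⌊s / h⌋ := by exact_mod_cast this
  exact mul_nonneg hh.le this

lemma gridFloor_le {h : ℝ} (hh : 0 < h) (s : ℝ) : gridFloor h s ≤ s := by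
  have := Int.floor_le (s / h)
  rw [le_div_iff₀ hh] at this
  rw [gridFloor]
  linarith

lemma sub_gridFloor_lt {h : ℝ} (hh : 0 < h) (s : ℝ) : s - gridFloor h s < h := by
  have := Int.lt_floor_add_one (s / h)
  rw [div_lt_iff₀ hh] at this
  rw [gridFloor]
  linarith

lemma gridFloor_le_of_lt {h s : ℝ} (hh : 0 < h) {n : ℕ} (hs : s < (n + 1) * h) :
    gridFloor h s ≤ n * h := by
  have h1 : ⌊s / h⌋ < (n + 1 : ℤ) := by
    rw [Int.floor_lt, div_lt_iff₀ hh]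
    exact_mod_cast hs
  have h2 : (⌊s / h⌋ : ℝ) ≤ n := by exact_mod_cast Int.lt_add_one_iff.1 h1
  rw [gridFloor, mul_comm]
  gcongr

/-- Countability of the jumps makes the delayed drift continuous almost everywhere, as dominated
convergence requires. -/
lemma countable_not_continuousAt_gridFloor {h : ℝ} (hh : 0 < h) :
    {s | ¬ContinuousAt (gridFloor h) s}.Countable := by
  refine (countable_range fun n : ℤ => h * (n : ℝ)).mono fun s hs => ?_
  by_contra hn
  refine hs (ContinuousAt.const_mul ?_ h)
  set n := ⌊s / h⌋ with hndef
  have h1 : (n : ℝ) < s / h := by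
    refine lt_of_le_of_ne (Int.floor_le _) fun he => hn ⟨n, ?_⟩
    simp only [he]
    field_simp
  have h2 : ∀ᶠ r in 𝓝 s, r / h ∈ Ioo (n : ℝ) (n + 1) :=
    (continuous_id.div_const h).continuousAt.eventually
      (isOpen_Ioo.mem_nhds ⟨h1, Int.lt_floor_add_one _⟩)
  refine (continuousAt_const (y := (n : ℝ))).congr ?_
  filter_upwards [h2] with r hr
  rw [Int.floor_eq_iff.2 ⟨hr.1.le, hr.2⟩]

section Recovery

variable {H : Type*} [NormedAddCommGroup H] [InnerProductSpace ℝ H]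

/-! ### The perturbed Volterra equation -/

lemma continuous_solOp_convolution {lam : ℕ → ℝ} {α β : ℝ} (hlam : ∀ k, 0 ≤ lam k)
    (φ : HilbertBasis ℕ ℝ H) (hα : α ∈ Ioo (0 : ℝ) 1) {T : ℝ} (hT : 0 < T) {g : ℝ → H} {K : ℝ}
    (hg : StronglyMeasurable g) (hK : ∀ s, ‖g s‖ ≤ K)
    (hgc : {s | ¬ContinuousAt g s}.Countable) :
    Continuous fun t : Icc (0 : ℝ) T =>
      ∫ s in (0 : ℝ)..t, solOp lam φ α β 0 (t - s) (g s) := by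
  have hG : 0 < Real.Gamma α := Real.Gamma_pos_of_pos hα.1
  have hK0 : 0 ≤ K := (norm_nonneg _).trans (hK 0)
  -- Substituting `u = t - s` fixes the singular kernel `S_0(u)` and leaves `t` only in `g (t - u)`
  -- and in the indicator. For almost every `u` both are continuous at `t₀`, and `u ^ (α - 1)`
  -- dominates up to a constant.
  have hrw : ∀ t : Icc (0 : ℝ) T, ∫ s in (0 : ℝ)..t, solOp lam φ α β 0 (t - s) (g s)
      = ∫ u in Ioc 0 T, (Ioc 0 (t : ℝ)).indicator
        (fun u => solOp lam φ α β 0 u (g (t - u))) u := by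
    intro t
    have h1 := intervalIntegral.integral_comp_sub_left (a := 0) (b := t)
      (fun u => solOp lam φ α β 0 u (g (t - u))) t
    simp only [sub_sub_cancel, sub_self, sub_zero] at h1
    rw [h1, intervalIntegral.integral_of_le t.2.1, setIntegral_indicator measurableSet_Ioc,
      inter_eq_self_of_subset_right (Ioc_subset_Ioc_right t.2.2)]
  simp_rw [hrw]
  rw [continuous_iff_continuousAt]
  intro t₀
  refine continuousAt_of_dominated
    (bound := fun u => (Real.Gamma α)⁻¹ * u ^ (α - 1) * K)
    (Eventually.of_forall fun t => ?_) (Eventually.of_forall fun t => ?_) ?_ ?_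
  · refine AEStronglyMeasurable.indicator ?_ measurableSet_Ioc
    refine aestronglyMeasurable_solOp hlam φ hα le_rfl measurable_id ?_
      (hg.comp_measurable (measurable_id.const_sub (t : ℝ))).aestronglyMeasurable
    filter_upwards [ae_restrict_mem measurableSet_Ioc] with u hu
    exact hu.1.le
  · filter_upwards [ae_restrict_mem measurableSet_Ioc] with u hu
    have hu0 := hu.1.le
    refine (norm_indicator_le_norm_self _ _).trans
      ((norm_solOp_le hlam φ hα le_rfl hu0 _).trans ?_)
    rw [add_zero]
    gcongr
    exact hK _
  · exact (((intervalIntegrable_iff_integrableOn_Ioc_of_le hT.le).1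
      (intervalIntegral.intervalIntegrable_rpow' (by linarith [hα.1]))).const_mul _).mul_const _
  · have hcount : {u : ℝ | ¬ContinuousAt g (t₀ - u)}.Countable :=
      hgc.preimage (f := fun u : ℝ => (t₀ : ℝ) - u) sub_right_injective
    filter_upwards [ae_restrict_mem measurableSet_Ioc,
      ae_restrict_of_ae (hcount.ae_notMem volume),
      ae_restrict_of_ae (volume.ae_ne (t₀ : ℝ))] with u hu hcu hne
    have hcu : ContinuousAt g (t₀ - u) := not_not.1 hcu
    rcases lt_or_gt_of_ne hne with hlt | hgt
    · have hev : ∀ᶠ t : Icc (0 : ℝ) T in 𝓝 t₀, u < t :=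
        continuous_subtype_val.continuousAt.eventually (lt_mem_nhds hlt)
      have hc : ContinuousAt (fun t : Icc (0 : ℝ) T => g ((t : ℝ) - u)) t₀ :=
        ContinuousAt.comp (f := fun t : Icc (0 : ℝ) T => (t : ℝ) - u) hcu (by fun_prop)
      refine ((continuous_solOp (β := β) hlam φ hα le_rfl hu.1.le).continuousAt.comp hc).congr ?_
      filter_upwards [hev] with t ht
      exact (indicator_of_mem (s := Ioc 0 (t : ℝ)) ⟨hu.1, ht.le⟩
        (fun u => solOp lam φ α β 0 u (g ((t : ℝ) - u)))).symm
    · have hev : ∀ᶠ t : Icc (0 : ℝ) T in 𝓝 t₀, (t : ℝ) < u :=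
        continuous_subtype_val.continuousAt.eventually (gt_mem_nhds hgt)
      refine (continuousAt_const (y := (0 : H))).congr ?_
      filter_upwards [hev] with t ht
      rw [indicator_of_notMem fun h => absurd h.2 (not_le.2 ht)]

/-- The equation for the Euler skeleton solution with the same control as a given path `x`. -/
lemma exists_perturbed_solution {lam : ℕ → ℝ} {α β : ℝ} (hlam : ∀ k, 0 ≤ lam k)
    (φ : HilbertBasis ℕ ℝ H) (hα : α ∈ Ioo (0 : ℝ) 1) {F : H → H} (hF : DriftAssumption F)
    {T : ℝ} (hT : 0 < T) (x : C(Icc (0 : ℝ) T, H)) {M : ℕ} (hM : 0 < M) :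
    ∃ z : C(Icc (0 : ℝ) T, H), ∀ t : Icc (0 : ℝ) T,
      z t = x t + ∫ s in (0 : ℝ)..t, solOp lam φ α β 0 (t - s)
        (F (IccExtend hT.le z (gridFloor (T / M) s)) - F (IccExtend hT.le x s)) := by
  obtain ⟨L, hL, hFg, hFl⟩ := hF.exists_lipschitz
  have hFc := continuous_of_lipschitz_bound hFl
  have hM' : (0 : ℝ) < M := by exact_mod_cast hM
  set h : ℝ := T / M with hh
  have hhpos : 0 < h := by positivity
  have hstep : ∀ z : C(Icc (0 : ℝ) T, H), ∃ z' : C(Icc (0 : ℝ) T, H), ∀ t : Icc (0 : ℝ) T,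
      z' t = x t + ∫ s in (0 : ℝ)..t, solOp lam φ α β 0 (t - s)
        (F (IccExtend hT.le z (gridFloor h s)) - F (IccExtend hT.le x s)) := by
    intro z
    have hc := continuous_solOp_convolution (β := β) hlam φ hα hT
      (g := fun s => F (IccExtend hT.le z (gridFloor h s)) - F (IccExtend hT.le x s))
      (K := L * (1 + ‖z‖) + L * (1 + ‖x‖))
      ((stronglyMeasurable_drift hFc hT (measurable_gridFloor h) z).sub
        (stronglyMeasurable_drift hFc hT measurable_id x))
      (fun s => (norm_sub_le _ _).trans
        (add_le_add (norm_drift_le hL hFg hT z _) (norm_drift_le hL hFg hT x _)))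
      ((countable_not_continuousAt_gridFloor hhpos).mono
        (show {s | ¬ContinuousAt _ s} ⊆ {s | ¬ContinuousAt (gridFloor h) s} from
          fun s hs hcont => hs ?_))
    · exact ⟨⟨_, x.continuous.add hc⟩, fun t => rfl⟩
    · exact ((hFc.comp z.continuous.Icc_extend').continuousAt.comp hcont).sub
        (hFc.comp x.continuous.Icc_extend').continuousAt
  choose Φ hΦ using hstep
  -- The delayed drift on a grid cell reads the path only at earlier grid points. Hence each Picard
  -- step settles one more cell, and `M` steps reach an exact fixed point without any contraction.
  have key : ∀ (n : ℕ) (t : Icc (0 : ℝ) T), (t : ℝ) ≤ n * h → Φ^[n + 1] x t = Φ^[n] x t := by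
    intro n
    induction n with
    | zero =>
      intro t ht
      have ht0 : (t : ℝ) = 0 := le_antisymm (by simpa using ht) t.2.1
      simp only [zero_add, Function.iterate_one, Function.iterate_zero, id_eq]
      rw [hΦ, ht0, intervalIntegral.integral_same, add_zero]
    | succ n ih =>
      intro t ht
      rw [Function.iterate_succ_apply' Φ (n + 1), Function.iterate_succ_apply' Φ n, hΦ, hΦ]
      congr 1
      refine intervalIntegral.integral_congr_ae ?_
      -- The endpoint `s = t` must be discarded: if `t = (n + 1) * h`, then `gridFloor h t` is `t`
      -- itself, beyond the range of the induction hypothesis.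
      filter_upwards [volume.ae_ne (t : ℝ)] with s hne hs
      rw [uIoc_of_le t.2.1] at hs
      have hst : s < t := lt_of_le_of_ne hs.2 hne
      have hmem : gridFloor h s ∈ Icc 0 T :=
        ⟨gridFloor_nonneg hhpos hs.1.le, (gridFloor_le hhpos s).trans (hs.2.trans t.2.2)⟩
      rw [IccExtend_of_mem _ _ hmem, IccExtend_of_mem _ _ hmem,
        ← Function.iterate_succ_apply' Φ n, ih ⟨_, hmem⟩ (gridFloor_le_of_lt hhpos (hst.trans_le (by exact_mod_cast ht)))]
  have hfix : Φ (Φ^[M] x) = Φ^[M] x := by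
    ext t
    rw [← Function.iterate_succ_apply' Φ M]
    refine key M t (t.2.2.trans (le_of_eq ?_))
    rw [hh]
    field_simp
  refine ⟨Φ^[M] x, fun t => ?_⟩
  conv_lhs => rw [← hfix]
  exact hΦ _ t

/-- Time reversal factors out `exp (l * t)`, and extension to the half-line gives a Gamma integral.
The remaining factor `l ^ (-α)` is what a large weight makes small. -/
lemma integral_sub_rpow_mul_exp_le {α l t : ℝ} (hα : 0 < α) (hl : 0 < l) (ht : 0 ≤ t) :
    ∫ s in (0 : ℝ)..t, (t - s) ^ (α - 1) * Real.exp (l * s)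
      ≤ Real.exp (l * t) * ((1 / l) ^ α * Real.Gamma α) := by
  have hval := Real.integral_rpow_mul_exp_neg_mul_Ioi hα hl
  have hpos : 0 < (1 / l) ^ α * Real.Gamma α := by
    have := Real.Gamma_pos_of_pos hα
    positivity
  have hint : IntegrableOn (fun u : ℝ => u ^ (α - 1) * Real.exp (-(l * u))) (Ioi 0) := by
    -- A non-integrable function has integral `0` by convention, contrary to the positive value in
    -- `hval`.
    by_contra hn
    rw [integral_undef hn] at hval
    exact hpos.ne hval
  have e : ∫ s in (0 : ℝ)..t, (t - s) ^ (α - 1) * Real.exp (l * s)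
      = Real.exp (l * t) * ∫ u in (0 : ℝ)..t, u ^ (α - 1) * Real.exp (-(l * u)) := by
    have := intervalIntegral.integral_comp_sub_left (a := 0) (b := t)
      (fun u => Real.exp (l * t) * (u ^ (α - 1) * Real.exp (-(l * u)))) t
    rw [sub_self, sub_zero] at this
    rw [← intervalIntegral.integral_const_mul, ← this]
    refine intervalIntegral.integral_congr fun s _ => ?_
    rw [mul_left_comm, ← Real.exp_add]
    ring_nf
  rw [e, ← hval, intervalIntegral.integral_of_le ht]
  refine mul_le_mul_of_nonneg_left ?_ (Real.exp_nonneg _)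
  refine setIntegral_mono_set hint ?_ Ioc_subset_Ioi_self.eventuallyLE
  filter_upwards [ae_restrict_mem measurableSet_Ioi] with u hu
  have : (0 : ℝ) < u := hu
  positivity

/-- Stability of the perturbed Volterra equation, by an exponentially weighted norm. -/
lemma dist_perturbed_solution_le {lam : ℕ → ℝ} {α β : ℝ} (hlam : ∀ k, 0 ≤ lam k)
    (φ : HilbertBasis ℕ ℝ H) (hα : α ∈ Ioo (0 : ℝ) 1) {F : H → H} {L l : ℝ} (hL : 0 < L)
    (hFl : ∀ u w, ‖F u - F w‖ ≤ L * ‖u - w‖) (hl : 0 < l) (hLl : L * (1 / l) ^ α ≤ 1 / 2)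
    {T : ℝ} (hT : 0 < T) {ρ : ℝ → ℝ} (hρ : ∀ s ∈ Icc 0 T, 0 ≤ ρ s ∧ ρ s ≤ s) {e : ℝ} (he : 0 ≤ e)
    (x z : C(Icc (0 : ℝ) T, H))
    (hx : ∀ s ∈ Icc 0 T, ‖IccExtend hT.le x (ρ s) - IccExtend hT.le x s‖ ≤ e)
    (hz : ∀ t : Icc (0 : ℝ) T, z t = x t + ∫ s in (0 : ℝ)..t, solOp lam φ α β 0 (t - s)
        (F (IccExtend hT.le z (ρ s)) - F (IccExtend hT.le x s))) :
    dist z x ≤ Real.exp (l * T) * (2 * ((Real.Gamma α)⁻¹ * L * (T ^ α / α))) * e := by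
  have hα0 := hα.1
  have hG : 0 < Real.Gamma α := Real.Gamma_pos_of_pos hα.1
  set c := (Real.Gamma α)⁻¹ * L * (T ^ α / α) with hc
  have hc0 : 0 ≤ c := by positivity
  have : Nonempty (Icc (0 : ℝ) T) := ⟨⟨0, le_rfl, hT.le⟩⟩
  -- The equation is estimated at the point maximising the weighted distance. As `ρ s ≤ s`, the
  -- delayed value obeys the same weighted bound.
  obtain ⟨t, -, ht⟩ := isCompact_univ.exists_isMaxOn univ_nonempty
    (f := fun t : Icc (0 : ℝ) T => Real.exp (-(l * t)) * ‖z t - x t‖)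
    (by fun_prop : Continuous _).continuousOn
  set D := Real.exp (-(l * t)) * ‖z t - x t‖ with hD
  have hD0 : 0 ≤ D := by positivity
  have hDle : ∀ s : Icc (0 : ℝ) T, ‖z s - x s‖ ≤ Real.exp (l * s) * D := by
    intro s
    have h1 : Real.exp (-(l * s)) * ‖z s - x s‖ ≤ D := ht (mem_univ s)
    calc ‖z s - x s‖ = Real.exp (l * s) * (Real.exp (-(l * s)) * ‖z s - x s‖) := by
          rw [← mul_assoc, ← Real.exp_add]; simp
      _ ≤ _ := by gcongr
  have hDt : ‖z t - x t‖ = Real.exp (l * t) * D := by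
    rw [hD, ← mul_assoc, ← Real.exp_add]; simp
  have hbound : ‖z t - x t‖ ≤ (Real.Gamma α)⁻¹ * ∫ s in (0 : ℝ)..t,
      ((t : ℝ) - s) ^ (α - 1) * (L * (Real.exp (l * s) * D + e)) := by
    rw [hz t, add_sub_cancel_left]
    refine norm_integral_solOp_zero_le hlam φ hα t.2.1 (by fun_prop) fun s hs => ?_
    have hsT : s ∈ Icc 0 T := ⟨hs.1.le, hs.2.trans t.2.2⟩
    obtain ⟨h1, h2⟩ := hρ s hsT
    have hmem : ρ s ∈ Icc 0 T := ⟨h1, h2.trans hsT.2⟩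
    refine (hFl _ _).trans ?_
    gcongr
    refine (norm_sub_le_norm_sub_add_norm_sub _ (IccExtend hT.le x (ρ s)) _).trans
      (add_le_add ?_ (hx s hsT))
    rw [IccExtend_of_mem _ _ hmem, IccExtend_of_mem _ _ hmem]
    refine (hDle ⟨_, hmem⟩).trans ?_
    simp only
    gcongr
  have hi := intervalIntegrable_sub_rpow (p := α - 1) (by linarith) (t : ℝ)
  have hsplit : ∫ s in (0 : ℝ)..t, ((t : ℝ) - s) ^ (α - 1) * (L * (Real.exp (l * s) * D + e))
      = L * D * (∫ s in (0 : ℝ)..t, ((t : ℝ) - s) ^ (α - 1) * Real.exp (l * s))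
        + L * e * ((t : ℝ) ^ α / α) := by
    rw [← integral_sub_rpow hα0, ← intervalIntegral.integral_const_mul,
      ← intervalIntegral.integral_const_mul, ← intervalIntegral.integral_add
        ((hi.mul_continuousOn (by fun_prop)).const_mul _) (hi.const_mul _)]
    refine intervalIntegral.integral_congr fun s _ => ?_
    ring
  have h1 := integral_sub_rpow_mul_exp_le hα0 hl t.2.1
  have h2 : (t : ℝ) ^ α ≤ T ^ α := Real.rpow_le_rpow t.2.1 t.2.2 hα0.le
  have h3 : ‖z t - x t‖ ≤ (Real.Gamma α)⁻¹ * (L * D * (Real.exp (l * t) *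
      ((1 / l) ^ α * Real.Gamma α)) + L * e * (T ^ α / α)) := by
    refine hbound.trans ?_
    rw [hsplit]
    gcongr
  have h4 : (Real.Gamma α)⁻¹ * (L * D * (Real.exp (l * t) *
      ((1 / l) ^ α * Real.Gamma α)) + L * e * (T ^ α / α))
      = (L * (1 / l) ^ α) * (Real.exp (l * t) * D) + c * e := by
    rw [hc]
    field_simp
  rw [h4, hDt] at h3
  -- The choice of `l` lets half of the left side absorb this term.
  have h5 : (L * (1 / l) ^ α) * (Real.exp (l * t) * D) ≤ 1 / 2 * (Real.exp (l * t) * D) := by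
    gcongr
  have h6 : D ≤ Real.exp (l * t) * D :=
    le_mul_of_one_le_left hD0 (Real.one_le_exp (mul_nonneg hl.le t.2.1))
  have h7 : D ≤ 2 * c * e := by linarith
  refine (ContinuousMap.dist_le (by positivity)).2 fun s => ?_
  rw [dist_eq_norm]
  calc ‖z s - x s‖ ≤ Real.exp (l * s) * D := hDle s
    _ ≤ Real.exp (l * T) * (2 * c * e) := by
      gcongr
      exact s.2.2
    _ = _ := by ring

end Recovery

section GammaConvergence

variable {H : Type*} [NormedAddCommGroup H]

/-! ### Γ-convergence of the rate functions -/

lemma eventually_norm_gridFloor_sub_le {T : ℝ} (hT : 0 < T) (x : C(Icc (0 : ℝ) T, H)) {e : ℝ}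
    (he : 0 < e) :
    ∀ᶠ M : ℕ in atTop, ∀ s ∈ Icc 0 T,
      ‖IccExtend hT.le x (gridFloor (T / M) s) - IccExtend hT.le x s‖ ≤ e := by
  have huc : UniformContinuous (IccExtend hT.le x) :=
    (CompactSpace.uniformContinuous_of_continuous x.continuous).comp
      (LipschitzWith.projIcc hT.le).uniformContinuous
  obtain ⟨δ, hδ, h⟩ := Metric.uniformContinuous_iff.1 huc e he
  have hlim : Tendsto (fun M : ℕ => T / (M : ℝ)) atTop (𝓝 0) :=
    tendsto_const_div_atTop_nhds_zero_nat T
  filter_upwards [hlim.eventually_lt_const hδ, eventually_gt_atTop 0] with M hM hM0 s _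
  have hM' : (0 : ℝ) < M := by exact_mod_cast hM0
  have hh : 0 < T / M := by positivity
  rw [← dist_eq_norm]
  refine (h ?_).le
  rw [Real.dist_eq, abs_sub_comm, abs_of_nonneg (by linarith [gridFloor_le hh s])]
  exact (sub_gridFloor_lt hh s).trans hM

lemma exists_weight {α : ℝ} (hα : 0 < α) (L : ℝ) : ∃ l : ℝ, 0 < l ∧ L * (1 / l) ^ α ≤ 1 / 2 := by
  have h : Tendsto (fun l : ℝ => L * (1 / l) ^ α) atTop (𝓝 0) := by
    have h1 := (tendsto_rpow_neg_atTop hα).const_mul L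
    rw [mul_zero] at h1
    refine h1.congr' ?_
    filter_upwards [eventually_gt_atTop 0] with l hl
    rw [one_div, Real.inv_rpow hl.le, Real.rpow_neg hl.le]
  obtain ⟨l, hl, hl0⟩ := ((h.eventually_le_const (by norm_num : (0 : ℝ) < 1 / 2)).and
    (eventually_gt_atTop 0)).exists
  exact ⟨l, hl0, hl⟩

/-- A cost `a` corresponds to the `L²` radius `√(2a)`, because of the factor `1/2` in the rate. -/
lemma ofReal_sqrt_sq_two_mul {a : ℝ≥0∞} (ha : a ≠ ∞) :
    ENNReal.ofReal (Real.sqrt (2 * a.toReal) ^ 2) = 2 * a := by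
  rw [Real.sq_sqrt (by positivity), ENNReal.ofReal_mul (by norm_num), ENNReal.ofReal_toReal ha]
  simp

variable [InnerProductSpace ℝ H] [CompleteSpace H] {lam : ℕ → ℝ} {α β γ : ℝ}

lemma skeletonRate_le {φ : HilbertBasis ℕ ℝ H} {F : H → H} {Q : H →L[ℝ] H} {x₀ : H} {T : ℝ}
    {hT : 0 < T} {ρ : ℝ → ℝ} {x : C(Icc (0 : ℝ) T, H)} {v : ℝ → H} {a : ℝ≥0∞}
    (hv : IsControl Q T v) (hx : IsSkeletonSolution lam φ α β γ F x₀ hT ρ v x)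
    (ha : ∫⁻ s in Icc 0 T, normH0 Q (v s) ^ 2 ≤ 2 * a) :
    skeletonRate lam φ α β γ F Q x₀ hT ρ x ≤ a := by
  refine (iInf₂_le_of_le v hv (iInf_le _ hx)).trans ?_
  calc _ ≤ (1 / 2) * (2 * a) := by gcongr
    _ = a := by rw [← mul_assoc, one_div, ENNReal.inv_mul_cancel (by simp) (by simp), one_mul]

lemma exists_control_of_skeletonRate_lt {φ : HilbertBasis ℕ ℝ H} {F : H → H} {Q : H →L[ℝ] H}
    {x₀ : H} {T : ℝ} {hT : 0 < T} {ρ : ℝ → ℝ} {x : C(Icc (0 : ℝ) T, H)} {a : ℝ≥0∞}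
    (ha : skeletonRate lam φ α β γ F Q x₀ hT ρ x < a) :
    ∃ v, (IsControl Q T v ∧ IsSkeletonSolution lam φ α β γ F x₀ hT ρ v x) ∧
      ∫⁻ s in Icc 0 T, normH0 Q (v s) ^ 2 ≤ 2 * a := by
  simp only [skeletonRate, iInf_lt_iff] at ha
  obtain ⟨v, hv, hx, h⟩ := ha
  refine ⟨v, ⟨hv, hx⟩, ?_⟩
  calc _ = 2 * ((1 / 2) * ∫⁻ s in Icc 0 T, normH0 Q (v s) ^ 2) := by
        rw [← mul_assoc, one_div, ENNReal.mul_inv_cancel (by simp) (by simp), one_mul]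
    _ ≤ _ := by gcongr

variable (hlam : ∀ k, 0 ≤ lam k) (φ : HilbertBasis ℕ ℝ H) (hα : α ∈ Ioo (0 : ℝ) 1) (hγ : 0 ≤ γ)
  (hαγ : 1 / 2 < α + γ) {F : H → H} (hF : DriftAssumption F) {Q : H →L[ℝ] H} (hQ : Q.IsPositive)
  (x₀ : H) {T : ℝ} (hT : 0 < T)

include hlam hα hγ hαγ hF hQ in
/-- The infimum in the rate function is attained. -/
lemma exists_optimal_control {x : C(Icc (0 : ℝ) T, H)}
    (hx : rateExact lam φ α β γ F Q x₀ hT x ≠ ∞) :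
    ∃ v, (IsControl Q T v ∧ IsSkeletonSolution lam φ α β γ F x₀ hT id v x) ∧
      ∫⁻ s in Icc 0 T, normH0 Q (v s) ^ 2 ≤ 2 * rateExact lam φ α β γ F Q x₀ hT x := by
  set I := rateExact lam φ α β γ F Q x₀ hT x with hI
  have h1 : ∀ n : ℕ, ∃ v, (IsControl Q T v ∧ IsSkeletonSolution lam φ α β γ F x₀ hT id v x) ∧
      ∫⁻ s in Icc 0 T, normH0 Q (v s) ^ 2 ≤ 2 * (I + (n : ℝ≥0∞)⁻¹) := fun n =>
    exists_control_of_skeletonRate_lt (ENNReal.lt_add_right hx (by simp))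
  choose v hv hvI using h1
  have hlim : Tendsto (fun n : ℕ => 2 * (I + (n : ℝ≥0∞)⁻¹)) atTop (𝓝 (2 * I)) := by
    have := ENNReal.Tendsto.const_mul (a := 2)
      (tendsto_const_nhds.add ENNReal.tendsto_inv_nat_nhds_zero : Tendsto
        (fun n : ℕ => I + (n : ℝ≥0∞)⁻¹) atTop (𝓝 (I + 0))) (Or.inr (by simp))
    rwa [add_zero] at this
  -- Closedness is applied to the constant path `x` without delay, with a minimising sequence of
  -- controls.
  obtain ⟨u, hu1, hu2, hu3⟩ := exists_control_of_tendsto hlam φ hα hγ hαγ hF hQ x₀ hT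
    (Ultrafilter.of atTop) (ρ := fun _ => id) (fun _ => measurable_id) (y := fun _ => x) (x := x)
    tendsto_const_nhds (fun e he => Eventually.of_forall fun n s _ => by simpa using he.le)
    (v := v) (r := Real.sqrt (2 * I.toReal)) (Real.sqrt_nonneg _) (Eventually.of_forall hv)
    fun r' hr' => by
      refine Ultrafilter.of_le (f := atTop) ?_
      have hlt : 2 * I < ENNReal.ofReal (r' ^ 2) := by
        rw [← ofReal_sqrt_sq_two_mul hx]
        have h0 := Real.sqrt_nonneg (2 * I.toReal)
        have h0' : 0 < r' := h0.trans_lt hr'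
        rw [ENNReal.ofReal_lt_ofReal_iff (by positivity)]
        gcongr
      filter_upwards [hlim.eventually_lt_const hlt] with n hn
      exact (hvI n).trans hn.le
  exact ⟨u, ⟨hu1, hu2⟩, hu3.trans (ofReal_sqrt_sq_two_mul hx).le⟩

include hlam hα hγ hαγ hF hQ in
-- If `a` exceeds the liminf, the rates lie below `a` infinitely often. An ultrafilter concentrated
-- on those indices replaces a subsequence, and a weak limit of the near-optimal controls drives `x`
-- at cost at most `a`.
theorem rateExact_le_liminf {x : C(Icc (0 : ℝ) T, H)} {y : ℕ → C(Icc (0 : ℝ) T, H)}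
    (hyx : Tendsto y atTop (𝓝 x)) :
    rateExact lam φ α β γ F Q x₀ hT x
      ≤ liminf (fun M => rateMLE lam φ α β γ F Q x₀ hT M (y M)) atTop := by
  refine le_of_forall_gt_imp_ge_of_dense fun a ha => ?_
  rcases eq_or_ne a ∞ with rfl | haT
  · exact le_top
  have hfreq := frequently_lt_of_liminf_lt (by isBoundedDefault) ha
  have : (atTop ⊓ 𝓟 {M | rateMLE lam φ α β γ F Q x₀ hT M (y M) < a}).NeBot :=
    frequently_mem_iff_neBot.1 hfreq
  set U := Ultrafilter.of (atTop ⊓ 𝓟 {M | rateMLE lam φ α β γ F Q x₀ hT M (y M) < a}) with hU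
  have hUle := Ultrafilter.of_le (atTop ⊓ 𝓟 {M | rateMLE lam φ α β γ F Q x₀ hT M (y M) < a})
  have hUtop : (U : Filter ℕ) ≤ atTop := hUle.trans inf_le_left
  have hUlt : ∀ᶠ M in (U : Filter ℕ), rateMLE lam φ α β γ F Q x₀ hT M (y M) < a :=
    le_principal_iff.1 (hUle.trans inf_le_right)
  obtain ⟨v, hv⟩ := (hUlt.mono fun M hM => exists_control_of_skeletonRate_lt hM).choice
  obtain ⟨u, hu1, hu2, hu3⟩ := exists_control_of_tendsto hlam φ hα hγ hαγ hF hQ x₀ hT U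
    (ρ := fun M : ℕ => gridFloor (T / M)) (fun _ => measurable_gridFloor _)
    -- The delayed paths converge uniformly to `x`: one half of the error is `dist (y M) x`, the
    -- other the modulus of continuity of `x` at scale `T / M`.
    (hyx.mono_left hUtop) (fun e he => by
      refine Eventually.filter_mono hUtop ?_
      filter_upwards [eventually_norm_gridFloor_sub_le hT x (half_pos he),
        Metric.tendsto_nhds.1 hyx (e / 2) (half_pos he)] with M h1 h2 s hs
      refine (norm_sub_le_norm_sub_add_norm_sub _ (IccExtend hT.le x (gridFloor (T / M) s))
        _).trans ?_
      have h3 : ‖IccExtend hT.le (y M) (gridFloor (T / M) s)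
          - IccExtend hT.le x (gridFloor (T / M) s)‖ ≤ dist (y M) x := by
        rw [← dist_eq_norm]
        exact ContinuousMap.dist_apply_le_dist _
      linarith [h1 s hs])
    (v := v) (r := Real.sqrt (2 * a.toReal)) (Real.sqrt_nonneg _) (hv.mono fun _ h => h.1)
    fun r' hr' => by
      filter_upwards [hv] with M hM
      refine hM.2.trans ?_
      rw [← ofReal_sqrt_sq_two_mul haT]
      gcongr
  exact skeletonRate_le hu1 hu2 (hu3.trans (ofReal_sqrt_sq_two_mul haT).le)

include hlam hα hγ hαγ hF hQ in
-- The optimal control of `x` is reused for every `M ≥ 1`. Since `x` already contains the control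
-- integral, the Euler path is sought as `x` plus a drift correction, whose continuity involves
-- `S_0` alone.
theorem exists_recovery_sequence (x : C(Icc (0 : ℝ) T, H)) :
    ∃ y : ℕ → C(Icc (0 : ℝ) T, H), Tendsto y atTop (𝓝 x) ∧
      limsup (fun M => rateMLE lam φ α β γ F Q x₀ hT M (y M)) atTop
        ≤ rateExact lam φ α β γ F Q x₀ hT x := by
  classical
  rcases eq_or_ne (rateExact lam φ α β γ F Q x₀ hT x) ∞ with hI | hI
  · exact ⟨fun _ => x, tendsto_const_nhds, hI ▸ le_top⟩
  obtain ⟨v, ⟨hv, hx⟩, hvI⟩ := exists_optimal_control hlam φ hα hγ hαγ hF hQ x₀ hT hI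
  obtain ⟨L, hL, hFg, hFl⟩ := hF.exists_lipschitz
  have hFc := continuous_of_lipschitz_bound hFl
  have hex : ∀ M : ℕ, ∃ z : C(Icc (0 : ℝ) T, H), 0 < M → ∀ t : Icc (0 : ℝ) T,
      z t = x t + ∫ s in (0 : ℝ)..t, solOp lam φ α β 0 (t - s)
        (F (IccExtend hT.le z (gridFloor (T / M) s)) - F (IccExtend hT.le x s)) := fun M => by
    rcases Nat.eq_zero_or_pos M with h | h
    -- For `M = 0` there is no grid; any path serves, as only large `M` matter.
    · exact ⟨x, fun h' => absurd h' (by omega)⟩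
    · obtain ⟨z, hz⟩ := exists_perturbed_solution (β := β) hlam φ hα hF hT x h
      exact ⟨z, fun _ => hz⟩
  choose z hz using hex
  refine ⟨z, ?_, limsup_le_of_le (by isBoundedDefault) ?_⟩
  · obtain ⟨l, hl, hLl⟩ := exists_weight hα.1 L
    rw [Metric.tendsto_nhds]
    intro e he
    have hG : 0 < Real.Gamma α := Real.Gamma_pos_of_pos hα.1
    have hα0 := hα.1
    set c := Real.exp (l * T) * (2 * ((Real.Gamma α)⁻¹ * L * (T ^ α / α))) with hc
    have hc0 : 0 < c := by positivity
    filter_upwards [eventually_norm_gridFloor_sub_le hT x (e := e / (2 * c)) (by positivity),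
      eventually_gt_atTop 0] with M hM hM0
    have hh : 0 < T / M := by
      have : (0 : ℝ) < M := by exact_mod_cast hM0
      positivity
    refine (dist_perturbed_solution_le hlam φ hα hL hFl hl hLl hT
      (fun s hs => ⟨gridFloor_nonneg hh hs.1, gridFloor_le hh s⟩) (e := e / (2 * c))
      (by positivity) x (z M) hM (hz M hM0)).trans_lt ?_
    rw [← hc]
    calc c * (e / (2 * c)) = e / 2 := by field_simp
      _ < e := by linarith
  · filter_upwards [eventually_gt_atTop 0] with M hM0
    refine skeletonRate_le hv (fun t => ?_) hvI
    have hsub := integral_solOp_zero_sub (β := β) hlam φ hα t.2.1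
      (K := max (L * (1 + ‖z M‖)) (L * (1 + ‖x‖)))
      (stronglyMeasurable_drift hFc hT (measurable_gridFloor (T / M)) (z M))
      (stronglyMeasurable_drift hFc hT measurable_id x)
      (fun s => (norm_drift_le hL hFg hT (z M) _).trans (le_max_left _ _))
      (fun s => (norm_drift_le hL hFg hT x _).trans (le_max_right _ _))
    have hxt := hx t
    simp only [id_eq] at hsub hxt
    -- Inserting the equation of `x` cancels its drift integral and leaves the Euler skeleton
    -- equation with the same control.
    rw [hz M hM0 t, hsub, hxt]
    abel

end GammaConvergence

end FracDiff

end

/-! ### The theorem with a random initial value. -/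

theorem mainTheorem4
    {d : ℕ} (hd : d = 1 ∨ d = 2 ∨ d = 3)
    (D : Set (FracDiff.Rd d)) (hD : FracDiff.IsConvexPolygonalDomain D)
    (lam : ℕ → ℝ) (φ : HilbertBasis ℕ ℝ (FracDiff.L2 D))
    (hA : FracDiff.IsDirichletEigensequence D lam φ)
    {α β γ T p : ℝ} (hα : α ∈ Set.Ioo (0 : ℝ) 1) (hβ : β ∈ Set.Ioc (0 : ℝ) 1)
    (hγ : γ ∈ Set.Icc (0 : ℝ) 1) (hαγ : 1 / 2 < α + γ) (hT : 0 < T) (hp : 2 ≤ p)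
    (Q : FracDiff.L2 D →L[ℝ] FracDiff.L2 D) (hQ : Q.IsPositive)
    (hnoise : FracDiff.NoiseAssumption lam φ α β γ Q)
    (F : FracDiff.L2 D → FracDiff.L2 D) (hF : FracDiff.DriftAssumption F)
    {Ω : Type*} [MeasurableSpace Ω] (P : MeasureTheory.Measure Ω)
    [MeasureTheory.IsProbabilityMeasure P]
    (X₀ : Ω → FracDiff.L2 D) (hX₀ : MeasureTheory.AEStronglyMeasurable X₀ P)
    (hX₀p : ∫⁻ ω, FracDiff.sobNorm lam φ (2 * β) (X₀ ω) ^ p ∂P < ⊤) :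
    ∀ᵐ ω ∂P, FracDiff.GammaConverges
      (fun M : ℕ => FracDiff.rateMLE lam φ α β γ F Q (X₀ ω) hT M)
      (FracDiff.rateExact lam φ α β γ F Q (X₀ ω) hT) := by
  have hlam : ∀ k, 0 ≤ lam k := fun k => (hA.1.trans_le (hA.2.1 (Nat.zero_le k))).le
  -- Both inequalities hold for each fixed initial value in `H`, hence at every `ω`.
  exact Filter.Eventually.of_forall fun ω =>
    ⟨fun _ _ hy => FracDiff.rateExact_le_liminf hlam φ hα hγ.1 hαγ hF hQ (X₀ ω) hT hy,
      FracDiff.exists_recovery_sequence hlam φ hα hγ.1 hαγ hF hQ (X₀ ω) hT⟩
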